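/- Let $p$ be a prime and let $\pi\colon Y\to X$ be a finite surjective morphism of Noetherian normal integral $F$-finite schemes of characteristic $p$ (no separability of $K(X)\subseteq K(Y)$ is assumed). Let $\Delta_X$ be a (not necessarily effective) $\mathbb{Q}$-divisor on $X$, $\mathfrak{a}\subseteq\mathcal{O}_X$ a nonzero (quasi-coherent) ideal sheaf and $t\ge 0$ a real number, and let $\mathfrak{T}\colon \pi_*K(Y)\to K(X)$ be a nonzero $\mathcal{O}_X$-linear map. For a $\mathbb{Z}$-divisor $D$, $\mathcal{O}(D)$ denotes the sheaf of rational functions $f$ with $f=0$ or $\operatorname{div}f+D\ge 0$; the pullback $\pi^*D$ has, at a prime divisor $C$ of $Y$, the coefficient of $D$ at $\pi(C)$ times the ramification index of $\pi$ along $C$. *Test ideals.* Let $U=\operatorname{Spec}R$ be a nonempty affine open of a normal integral $F$-finite scheme, $\Delta$ a $\mathbb{Q}$-divisor, $I\subseteq R$ a nonzero ideal. If $\Delta\ge 0$ on $U$, then $\tau_b(U;\Delta,I^t)$ is the smallest nonzero ideal $J$ of $R$ with $\phi\big((I^{\lceil t(p^e-1)\rceil}J)^{1/p^e}\big)\subseteq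 J$ for all $e\ge 0$ and all $\phi\in\operatorname{Hom}_R(R^{1/p^e},R)$ that extend to an $R$-linear map $R(\lceil (p^e-1)\Delta\rceil)^{1/p^e}\to R$. For arbitrary $\Delta$, choose $0\ne f\in R$ with $\Delta+\operatorname{div}f\ge 0$ on $U$ and put $\tau_b(U;\Delta,I^t)=\frac1f\,\tau_b(U;\Delta+\operatorname{div}f,I^t)$, a fractional ideal of $R$. On a general scheme $\tau_b$ is the subsheaf of the function field with these sections over affine opens. Then there is a unique divisor $\mathcal{R}_{\mathfrak{T}}$ on $Y$ such that $g\mapsto\mathfrak{T}(g\cdot -)$ identifies $\pi_*\mathcal{O}_Y(\mathcal{R}_{\mathfrak{T}})$ with $\mathcal{H}om_{\mathcal{O}_X}(\pi_*\mathcal{O}_Y,\mathcal{O}_X)$ (i.e. $\mathcal{R}_{\mathfrak{T}}$ is the divisor of $\mathfrak{T}$ as a rational section of this rank one reflexive $\mathcal{O}_Y$-module). It satisfies $\mathcal{R}_{\mathfrak{T}}\sim K_Y-\pi^*K_X$ whenever $K_X$, $K_Y$ are divisors with $\mathcal{O}_Y(K_Y)\cong\mathcal{H}om_{\mathcal{O}_X}(\pi_*\mathcal{O}_Y,\mathcal{O}_X(K_X))$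 as $\mathcal{O}_Y$-modules (in particular for canonical divisors with $\omega_Y\cong\pi^!\omega_X$). Setting $\Delta_{Y/\mathfrak{T}}=\pi^*\Delta_X-\mathcal{R}_{\mathfrak{T}}$, the sheaf $\tau_b(X;\Delta_X,\mathfrak{a}^t)$ is nonzero and $$\mathfrak{T}\big(\pi_*\tau_b(Y;\Delta_{Y/\mathfrak{T}},(\mathfrak{a}\cdot\mathcal{O}_Y)^t)\big)=\tau_b(X;\Delta_X,\mathfrak{a}^t),$$ that is, over every nonempty affine open $U\subseteq X$, $\mathfrak{T}$ maps the sections of $\tau_b(Y;\Delta_{Y/\mathfrak{T}},(\mathfrak{a}\cdot\mathcal{O}_Y)^t)$ over $\pi^{-1}(U)$ onto the sections of $\tau_b(X;\Delta_X,\mathfrak{a}^t)$ over $U$. -/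

import Mathlib

open AlgebraicGeometry CategoryTheory Order

universe u

noncomputable section

namespace TestIdeal

/-- A scheme is normal if all its local rings are integrally closed (domains). -/
def IsNormalScheme (X : Scheme.{u}) : Prop :=
  ∀ x : X, IsDomain (X.presheaf.stalk x) ∧ IsIntegrallyClosed (X.presheaf.stalk x)

/-- `X` is an `F`-finite scheme of characteristic `p`: the absolute Frobenius is a finite morphism,
that is, on every (nonempty) affine open `U` the ring `Γ(X, U)` has characteristic `p` and is
module-finite over itself via `r ↦ r ^ p`. -/
def IsFFinite (p : ℕ) [Fact p.Prime] (X : Scheme.{u}) : Prop :=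
  ∀ U : X.affineOpens, Nonempty U.1 →
    ∃ _ : CharP Γ(X, U) p, (frobenius Γ(X, U) p).Finite

/-- The group of Weil divisors on `X` with coefficients in `A`: cycles all of whose components are
(generic points of) prime divisors, i.e. points of codimension one. `A = ℤ` gives integral
divisors, `A = ℚ` gives `ℚ`-divisors. -/
def Divisor (X : Scheme.{u}) (A : Type) [AddCommGroup A] : AddSubgroup (AlgebraicCycle X A) where
  carrier := {D | ∀ x : X, D x ≠ 0 → coheight x = 1}
  zero_mem' := by
    intro x hx
    exact absurd rfl hx
  add_mem' := by
    intro D E hD hE x hx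
    by_cases h : D x = 0
    · refine hE x fun h' => hx ?_
      simp [h, h']
    · exact hD x h
  neg_mem' := by
    intro D hD x hx
    refine hD x fun h => hx ?_
    simp [h]

/-- An integral divisor regarded as a `ℚ`-divisor. -/
def Divisor.toRat {X : Scheme.{u}} (D : Divisor X ℤ) : Divisor X ℚ :=
  ⟨{  toFun := fun x => (D.1 x : ℚ)
      supportWithinDomain' := fun _ _ => trivial
      supportLocallyFiniteWithinDomain' := by
        intro z hz
        obtain ⟨s, hs, hf⟩ := D.1.supportLocallyFiniteWithinDomain' z hz
        refine ⟨s, hs, hf.subset ?_⟩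
        rintro x ⟨hxs, hx⟩
        refine ⟨hxs, fun h => hx ?_⟩
        change D.1 x = 0 at h
        simp [h] },
    fun x hx => D.2 x fun h => hx (by
      change ((D.1 x : ℤ) : ℚ) = 0
      simp [h])⟩

/-- The ramification index of `π` at `y`: the length of `𝒪_{Y,y} / 𝔪_x 𝒪_{Y,y}` with `x = π y`.
When `x` and `y` have codimension one on normal schemes this is `ord_y (π^* t)` for a uniformizer
`t` of the discrete valuation ring `𝒪_{X,x}`. -/
def ramIndex {X Y : Scheme.{u}} (π : Y ⟶ X) (y : Y) : ℕ :=
  (Module.length (Y.presheaf.stalk y) (Y.presheaf.stalk y ⧸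
    (IsLocalRing.maximalIdeal (X.presheaf.stalk (π y))).map (π.stalkMap y).hom)).toNat

open scoped Classical in
/-- The pullback `π^* D` of a divisor under a finite morphism: its coefficient at a prime divisor
`C` of `Y` is the coefficient of `D` at the image of `C` times the ramification index along `C`. -/
def Divisor.pullback {X Y : Scheme.{u}} (π : Y ⟶ X) [IsFinite π] {A : Type} [CommRing A]
    (D : Divisor X A) : Divisor Y A :=
  ⟨{  toFun := fun y => if coheight y = 1 then D.1 (π y) * (ramIndex π y : A) else 0
      supportWithinDomain' := fun _ _ => trivial
      supportLocallyFiniteWithinDomain' := by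
        intro z _
        obtain ⟨s, hs, hf⟩ := D.1.supportLocallyFiniteWithinDomain' (π z) trivial
        refine ⟨π ⁻¹' s, π.continuous.continuousAt.preimage_mem_nhds hs, ?_⟩
        refine (hf.preimage' fun x _ => π.finite_preimage_singleton x).subset ?_
        rintro y ⟨hys, hy⟩
        refine ⟨hys, fun h => hy ?_⟩
        change D.1 (π y) = 0 at h
        simp [h] },
    fun y hy => by
      by_contra h
      exact hy (if_neg h)⟩

instance nonempty_preimage {X Y : Scheme.{u}} (π : Y ⟶ X) [Surjective π] (U : X.Opens)
    [h : Nonempty U] : Nonempty (π ⁻¹ᵁ U) := by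
  obtain ⟨x, hx⟩ := h
  obtain ⟨y, rfl⟩ := π.surjective x
  exact ⟨⟨y, hx⟩⟩

section Sections

variable {X : Scheme.{u}} [AlgebraicGeometry.IsIntegral X] [AlgebraicGeometry.IsNoetherian X]

/-- The sections over `U` of the sheaf `𝒪_X(D) ⊆ K(X)`: rational functions `f` such that `f = 0` or
`div f + D ≥ 0` on `U`. -/
def divisorialSections (D : X → ℤ) (U : X.Opens) : Set X.functionField :=
  {f | f ≠ 0 → ∀ x ∈ U, coheight x = 1 → 0 ≤ Scheme.ord f x + D x}

/-- The set `I_{Δ,e}` over an affine open `U = Spec R`, for `Δ ≥ 0` on `U`: the elements of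
`Hom_R(R^{1/p^e}, R)` that come from `Hom_R(R(⌈(p^e - 1)Δ⌉)^{1/p^e}, R)`.
An `R`-linear map `R(D)^{1/p^e} → R` is the same as an additive map `R(D) → R` that is
`p^{-e}`-linear, and it extends uniquely to a `p^{-e}`-linear map `K → K` of the fraction field;
so `I_{Δ,e}` is given here as the set of all `p^{-e}`-linear maps `φ : K → K` with
`φ(R(⌈(p^e - 1)Δ⌉)) ⊆ R`. -/
def cartierMaps (p : ℕ) (Δ : X → ℚ) (e : ℕ) (U : X.Opens) [Nonempty U] :
    Set (X.functionField →+ X.functionField) :=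
  {φ | (∀ a b : X.functionField, φ (a ^ p ^ e * b) = a * φ b) ∧
    ∀ f ∈ divisorialSections (fun x => ⌈((p : ℚ) ^ e - 1) * Δ x⌉) U,
      φ f ∈ (algebraMap Γ(X, U) X.functionField).range}

/-- The big test ideal `τ_b(U; Δ, I^t)` of an affine open `U = Spec R`, for `Δ ≥ 0` on `U` and a
nonzero ideal `I` of `R`: the smallest nonzero ideal `J` of `R` such that
`φ ((I^⌈t(p^e - 1)⌉ J)^{1/p^e}) ⊆ J` for all `e ≥ 0` and all `φ ∈ I_{Δ,e}`. -/
def testIdealEffective (p : ℕ) (Δ : X → ℚ) (U : X.Opens) [Nonempty U] (I : Ideal Γ(X, U))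
    (t : ℝ) : Ideal Γ(X, U) :=
  sInf {J | J ≠ ⊥ ∧ ∀ e : ℕ, ∀ φ ∈ cartierMaps p Δ e U,
    ∀ z ∈ I ^ ⌈t * ((p : ℝ) ^ e - 1)⌉₊ * J, ∃ w ∈ J,
      φ (algebraMap Γ(X, U) X.functionField z) = algebraMap Γ(X, U) X.functionField w}

open scoped Classical in
/-- The big test ideal `τ_b(U; Δ, I^t)` of an affine open `U = Spec R`, for an arbitrary
`ℚ`-divisor `Δ`: choose a nonzero `f ∈ R` with `Δ + div f ≥ 0` on `U`; then it is the fractional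
ideal `f⁻¹ τ_b(U; Δ + div f, I^t) = {k ∈ K(X) | f k ∈ τ_b(U; Δ + div f, I^t)}`. -/
def bigTestIdeal (p : ℕ) (Δ : Divisor X ℚ) (U : X.Opens) [Nonempty U] (I : Ideal Γ(X, U))
    (t : ℝ) : Submodule Γ(X, U) X.functionField :=
  if h : ∃ f : Γ(X, U), f ≠ 0 ∧ ∀ x ∈ U, coheight x = 1 →
      0 ≤ Δ.1 x + (Scheme.ord (algebraMap Γ(X, U) X.functionField f) x : ℚ) then
    Submodule.comap (h.choose • LinearMap.id)
      (Submodule.map (Algebra.linearMap Γ(X, U) X.functionField)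
        (testIdealEffective p (fun x => Δ.1 x +
          (Scheme.ord (algebraMap Γ(X, U) X.functionField h.choose) x : ℚ)) U I t))
  else ⊥

/-- Linear equivalence of integral divisors. -/
def LinEquiv (D E : Divisor X ℤ) : Prop :=
  ∃ g : X.functionField, g ≠ 0 ∧ ∀ x : X, coheight x = 1 → D.1 x - E.1 x = Scheme.ord g x

end Sections

section Maps

variable {X Y : Scheme.{u}} [AlgebraicGeometry.IsIntegral X] [AlgebraicGeometry.IsIntegral Y]
  [AlgebraicGeometry.IsNoetherian X] [AlgebraicGeometry.IsNoetherian Y]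

/-- `T : π_* K(Y) → K(X)` is `𝒪_X`-linear. -/
def IsStructureSheafLinear (π : Y ⟶ X) [Surjective π]
    (T : Y.functionField →+ X.functionField) : Prop :=
  ∀ (U : X.Opens) [Nonempty U] (a : Γ(X, U)) (b : Y.functionField),
    T (algebraMap Γ(Y, π ⁻¹ᵁ U) Y.functionField (π.app U a) * b) =
      algebraMap Γ(X, U) X.functionField a * T b

/-- `g ↦ T(g · -)` identifies `π_* 𝒪_Y(D)` with `ℋom_{𝒪_X}(π_* 𝒪_Y, 𝒪_X(E))`. Equivalently, `D` is
the divisor of `T`, regarded as a rational section of the rank one reflexive `𝒪_Y`-module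
`π^! 𝒪_X(E) = ℋom_{𝒪_X}(π_* 𝒪_Y, 𝒪_X(E))`. -/
def IsDivisorOfMap (π : Y ⟶ X) [Surjective π] (T : Y.functionField →+ X.functionField)
    (E : Divisor X ℤ) (D : Divisor Y ℤ) : Prop :=
  ∀ (U : X.affineOpens) [Nonempty U.1] (g : Y.functionField),
    g ∈ divisorialSections D.1 (π ⁻¹ᵁ U.1) ↔
      ∀ s : Γ(Y, π ⁻¹ᵁ U.1), T (algebraMap Γ(Y, π ⁻¹ᵁ U.1) Y.functionField s * g) ∈
        divisorialSections E.1 U.1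

/-- `𝒪_Y(KY) ≅ π^! 𝒪_X(KX) = ℋom_{𝒪_X}(π_* 𝒪_Y, 𝒪_X(KX))` as `𝒪_Y`-modules. (Such an isomorphism
extends uniquely to the generic points and is then `g ↦ Θ(g · -)`, where `Θ` is the image of `1`.)
If `KX` is a canonical divisor of `X`, this says that `KY` is a canonical divisor of `Y`, by
`ω_Y ≅ π^! ω_X`. -/
def IsUpperShriek (π : Y ⟶ X) [Surjective π] (KX : Divisor X ℤ) (KY : Divisor Y ℤ) : Prop :=
  ∃ Θ : Y.functionField →+ X.functionField, Θ ≠ 0 ∧ IsStructureSheafLinear π Θ ∧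
    IsDivisorOfMap π Θ KX KY

end Maps

end TestIdeal

end

namespace TestIdeal

section Semilinear

theorem exists_generators_of_finite {A B : Type*} [CommRing A] [CommRing B] (σ : A →+* B)
    (hσ : σ.Finite) : ∃ (n : ℕ) (r : Fin n → B), ∀ x : B, ∃ s : Fin n → A,
      x = ∑ j, σ (s j) * r j := by
  algebraize [σ]
  obtain ⟨n, r, hr⟩ := Module.Finite.exists_fin (R := A) (M := B)
  refine ⟨n, r, fun x => ?_⟩
  have hx : x ∈ Submodule.span A (Set.range r) := hr ▸ Submodule.mem_top
  obtain ⟨s, hs⟩ := (Submodule.mem_span_range_iff_exists_fun A).1 hx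
  exact ⟨s, by rw [← hs]; simp [Algebra.smul_def, RingHom.algebraMap_toAlgebra]⟩

theorem finite_of_generators {A B : Type*} [CommRing A] [CommRing B] (σ : A →+* B)
    {n : ℕ} (r : Fin n → B) (h : ∀ x : B, ∃ s : Fin n → A, x = ∑ j, σ (s j) * r j) : σ.Finite := by
  classical
  let := σ.toAlgebra
  have : Module.Finite A B := by
    refine Module.Finite.of_fg_top ⟨Finset.univ.image r, ?_⟩
    rw [eq_top_iff]
    rintro x -
    rw [Finset.coe_image, Finset.coe_univ, Set.image_univ, Submodule.mem_span_range_iff_exists_fun]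
    obtain ⟨s, hs⟩ := h x
    exact ⟨s, by rw [hs]; simp [Algebra.smul_def, RingHom.algebraMap_toAlgebra]⟩
  exact this

theorem exists_ne_zero_dvd_of_finite {R S : Type*} [CommRing R] [CommRing S] [IsDomain S]
    (σ : R →+* S) (hσ : σ.Finite) {b : S} (hb : b ≠ 0) : ∃ r : R, r ≠ 0 ∧ b ∣ σ r := by
  have hintegral : σ.IsIntegralElem b := hσ.to_isIntegral b
  obtain ⟨q, hq, hq0⟩ := hintegral
  have := (σ.domain_nontrivial)
  have := Ideal.comap_ne_bot_of_root_mem (f := σ) (I := Ideal.span {b}) hb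
    (Ideal.mem_span_singleton_self b) hq.ne_zero hq0
  obtain ⟨r, hr, hr0⟩ := Submodule.exists_mem_ne_zero_of_ne_bot this
  exact ⟨r, hr0, Ideal.mem_span_singleton.1 hr⟩

/-- A finite ring homomorphism of domains induces a finite extension of fraction fields. -/
theorem finite_fractionField {R S K L : Type*} [CommRing R] [CommRing S] [IsDomain R] [IsDomain S]
    [Field K] [Field L] [Algebra R K] [Algebra S L] [IsFractionRing R K] [IsFractionRing S L]
    (σ : R →+* S) (τ : K →+* L) (hτ : ∀ a, τ (algebraMap R K a) = algebraMap S L (σ a))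
    (hσ : σ.Finite) : τ.Finite := by
  obtain ⟨n, r, hr⟩ := exists_generators_of_finite σ hσ
  refine finite_of_generators τ (fun j => algebraMap S L (r j)) fun x => ?_
  obtain ⟨a, b, hb, rfl⟩ := IsFractionRing.div_surjective (A := S) x
  obtain ⟨c, hc, d, hd⟩ := exists_ne_zero_dvd_of_finite σ hσ (nonZeroDivisors.ne_zero hb)
  obtain ⟨s, hs⟩ := hr (a * d)
  have hb0 : algebraMap S L b ≠ 0 := by simpa using nonZeroDivisors.ne_zero hb
  have hc0 : algebraMap R K c ≠ 0 := by simpa using hc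
  have hcL : algebraMap S L (σ c) ≠ 0 := by rw [← hτ]; simpa using hc
  have hd0 : algebraMap S L d ≠ 0 := by
    rintro h
    rw [hd, map_mul, h, mul_zero] at hcL
    exact hcL rfl
  refine ⟨fun j => algebraMap R K (s j) / algebraMap R K c, ?_⟩
  have : algebraMap S L a / algebraMap S L b = algebraMap S L (a * d) / algebraMap S L (σ c) := by
    rw [hd, map_mul, map_mul]
    field_simp
  rw [this, hs, map_sum, Finset.sum_div]
  refine Finset.sum_congr rfl fun j _ => ?_
  rw [map_div₀, hτ, hτ, map_mul]
  ring

/-- Over a finite extension of fields, every semilinear functional is a multiple of a given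
nonzero one. -/
theorem exists_eq_functional_mul {k V : Type*} [Field k] [Field V] (σ : k →+* V) (hσ : σ.Finite)
    (T Θ : V →+ k) (hT : ∀ a b, T (σ a * b) = a * T b) (hΘ : ∀ a b, Θ (σ a * b) = a * Θ b)
    (hT0 : T ≠ 0) : ∃ u : V, ∀ b, Θ b = T (b * u) := by
  let := σ.toAlgebra
  have : FiniteDimensional k V := hσ
  let T' : V →ₗ[k] k :=
    { T with
      map_smul' := fun a b => by
        simpa [Algebra.smul_def, RingHom.algebraMap_toAlgebra] using hT a b }
  let Θ' : V →ₗ[k] k :=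
    { Θ with
      map_smul' := fun a b => by
        simpa [Algebra.smul_def, RingHom.algebraMap_toAlgebra] using hΘ a b }
  let B : V →ₗ[k] Module.Dual k V := (LinearMap.mul k V).compr₂ T'
  have hB : ∀ u b, B u b = T (u * b) := fun u b => rfl
  have hinj : Function.Injective B := by
    rw [injective_iff_map_eq_zero]
    intro u hu
    by_contra hu0
    refine hT0 (AddMonoidHom.ext fun b => ?_)
    have := LinearMap.congr_fun hu (u⁻¹ * b)
    rw [hB, mul_inv_cancel_left₀ hu0] at this
    exact this
  have hsurj : Function.Surjective B :=
    (LinearMap.injective_iff_surjective_of_finrank_eq_finrank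
      (Subspace.dual_finrank_eq (K := k) (V := V)).symm).1 hinj
  obtain ⟨u, hu⟩ := hsurj Θ'
  refine ⟨u, fun b => ?_⟩
  have := LinearMap.congr_fun hu b
  rw [hB, mul_comm] at this
  exact this.symm

theorem functional_mul_injective {k V : Type*} [Field k] [Field V] {T : V →+ k} (hT0 : T ≠ 0)
    {u v : V} (h : ∀ b, T (b * u) = T (b * v)) : u = v := by
  by_contra huv
  have huv' : u - v ≠ 0 := sub_ne_zero.2 huv
  refine hT0 (AddMonoidHom.ext fun b => ?_)
  have := h (b / (u - v))
  rw [← sub_eq_zero, ← map_sub, ← mul_sub, div_mul_cancel₀ _ huv'] at this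
  exact this

/-- A finite extension of fields has a basis with its coordinate functionals. -/
theorem exists_coordinates {k V : Type*} [Field k] [Field V] (σ : k →+* V) (hσ : σ.Finite) :
    ∃ (n : ℕ) (b : Fin n → V) (l : Fin n → V →+ k), (∀ i a x, l i (σ a * x) = a * l i x) ∧
      ∀ x, x = ∑ i, σ (l i x) * b i := by
  let := σ.toAlgebra
  have : FiniteDimensional k V := hσ
  let B := Module.finBasis k V
  refine ⟨_, B, fun i => (B.coord i).toAddMonoidHom, fun i a x => ?_, fun x => ?_⟩
  · have := (B.coord i).map_smul a x
    rwa [Algebra.smul_def] at this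
  · conv_lhs => rw [← B.sum_repr x]
    refine Finset.sum_congr rfl fun i _ => ?_
    rw [Algebra.smul_def]
    rfl

theorem exists_functional_ne_zero {k V : Type*} [Field k] [Field V] (σ : k →+* V) (hσ : σ.Finite) :
    ∃ φ : V →+ k, (∀ a b, φ (σ a * b) = a * φ b) ∧ φ 1 = 1 := by
  obtain ⟨n, b, l, hl, hb⟩ := exists_coordinates σ hσ
  obtain ⟨i, hi⟩ : ∃ i, l i 1 ≠ 0 := by
    by_contra! h
    have := hb 1
    simp [h] at this
  refine ⟨(AddMonoidHom.mulLeft (l i 1)⁻¹).comp (l i), fun a b => ?_, ?_⟩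
  · simp [hl]; ring
  · simp [hi]

end Semilinear

section TestElement

/-- The `p^{-e}`-linear endomorphisms (`q = p ^ e`) of the field `K` that map `A` into itself. -/
def integralMaps (A K : Type*) [CommRing A] [Field K] [Algebra A K] (q : ℕ) : Set (K →+ K) :=
  {φ | (∀ a b, φ (a ^ q * b) = a * φ b) ∧
    ∀ r : A, φ (algebraMap A K r) ∈ (algebraMap A K).range}

variable {A K : Type*} [CommRing A] [Field K] [Algebra A K]

theorem zero_mem_integralMaps (q : ℕ) : (0 : K →+ K) ∈ integralMaps A K q :=
  ⟨by simp, fun _ => ⟨0, by simp⟩⟩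

theorem add_mem_integralMaps {q : ℕ} {φ ψ : K →+ K} (hφ : φ ∈ integralMaps A K q)
    (hψ : ψ ∈ integralMaps A K q) : φ + ψ ∈ integralMaps A K q :=
  ⟨fun a b => by simp [hφ.1, hψ.1, mul_add], fun r => add_mem (hφ.2 r) (hψ.2 r)⟩

theorem smul_mem_integralMaps {q : ℕ} {φ : K →+ K} (hφ : φ ∈ integralMaps A K q) (a : A) :
    (AddMonoidHom.mulLeft (algebraMap A K a)).comp φ ∈ integralMaps A K q :=
  ⟨fun x b => by simp only [AddMonoidHom.comp_apply, AddMonoidHom.coe_mulLeft, hφ.1]; ring,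
    fun r => mul_mem ⟨a, rfl⟩ (hφ.2 r)⟩

theorem comp_mulLeft_mem_integralMaps {q : ℕ} {φ : K →+ K} (hφ : φ ∈ integralMaps A K q) (a : A) :
    φ.comp (AddMonoidHom.mulLeft (algebraMap A K a)) ∈ integralMaps A K q :=
  ⟨fun x b => by
    simp only [AddMonoidHom.comp_apply, AddMonoidHom.coe_mulLeft]
    rw [mul_left_comm, hφ.1],
    fun r => by
      simp only [AddMonoidHom.comp_apply, AddMonoidHom.coe_mulLeft]
      rw [← map_mul]
      exact hφ.2 _⟩

theorem comp_mem_integralMaps {q q' : ℕ} {φ ψ : K →+ K} (hφ : φ ∈ integralMaps A K q)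
    (hψ : ψ ∈ integralMaps A K q') : φ.comp ψ ∈ integralMaps A K (q * q') :=
  ⟨fun a b => by simp only [AddMonoidHom.comp_apply]; rw [pow_mul, hψ.1, hφ.1], fun r => by
    obtain ⟨s, hs⟩ := hψ.2 r
    rw [AddMonoidHom.comp_apply, ← hs]
    exact hφ.2 s⟩

theorem id_mem_integralMaps : AddMonoidHom.id K ∈ integralMaps A K 1 :=
  ⟨by simp, fun r => ⟨r, rfl⟩⟩

/-- The ideal of all values at `d` of the `p^{-e}`-linear endomorphisms (`q = p ^ e`) of `A`. -/
def valueIdeal (A K : Type*) [CommRing A] [Field K] [Algebra A K] (q : ℕ) (d : A) : Ideal A where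
  carrier := {a | ∃ φ ∈ integralMaps A K q, φ (algebraMap A K d) = algebraMap A K a}
  zero_mem' := ⟨0, zero_mem_integralMaps q, by simp⟩
  add_mem' := by
    rintro a b ⟨φ, hφ, h⟩ ⟨ψ, hψ, h'⟩
    exact ⟨φ + ψ, add_mem_integralMaps hφ hψ, by simp [h, h']⟩
  smul_mem' := by
    rintro c a ⟨φ, hφ, h⟩
    exact ⟨_, smul_mem_integralMaps hφ c, by simp [h]⟩

section Free

variable [FaithfulSMul A K] {p n : ℕ} (b : Fin n → A) (l : Fin n → K →+ K)
  (hl : ∀ i, l i ∈ integralMaps A K p) (hb : ∀ x, x = ∑ i, (l i x) ^ p * algebraMap A K (b i))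

include hl hb in
theorem exists_coordinates_of_mem (a : A) :
    ∃ s : Fin n → A, (∀ i, l i (algebraMap A K a) = algebraMap A K (s i)) ∧
      a = ∑ i, (s i) ^ p * b i := by
  choose s hs using fun i => (hl i).2 a
  refine ⟨s, fun i => (hs i).symm, FaithfulSMul.algebraMap_injective A K ?_⟩
  rw [hb (algebraMap A K a), map_sum]
  simp [hs]

include hl hb in
theorem mem_pow_of_forall_map_mem (e : ℕ) (J : Ideal A) (x : A)
    (h : ∀ φ ∈ integralMaps A K (p ^ e), ∃ a ∈ J, φ (algebraMap A K x) = algebraMap A K a) :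
    x ∈ J ^ p ^ e := by
  induction e generalizing x with
  | zero =>
    obtain ⟨a, ha, hxa⟩ := h (AddMonoidHom.id K) (by simpa using id_mem_integralMaps)
    have : x = a := FaithfulSMul.algebraMap_injective A K hxa
    simpa [this] using ha
  | succ e ih =>
    obtain ⟨s, hs, hx⟩ := exists_coordinates_of_mem b l hl hb x
    rw [hx]
    refine Ideal.sum_mem _ fun i _ => Ideal.mul_mem_right _ _ ?_
    rw [pow_succ, pow_mul]
    refine Ideal.pow_mem_pow (ih _ fun φ hφ => ?_) _
    obtain ⟨a, ha, hxa⟩ := h (φ.comp (l i)) (by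
      rw [pow_succ]; exact comp_mem_integralMaps hφ (hl i))
    refine ⟨a, ha, ?_⟩
    rw [← hxa, AddMonoidHom.comp_apply, hs]

include hl hb in
theorem valueIdeal_le_succ (hp : 0 < p) (e : ℕ) (d : A) :
    valueIdeal A K (p ^ e) d ≤ valueIdeal A K (p ^ (e + 1)) d := by
  rintro a ⟨φ, hφ, h⟩
  obtain ⟨s, hs, hx⟩ := exists_coordinates_of_mem b l hl hb a
  rw [hx]
  refine Ideal.sum_mem _ fun i _ => Ideal.mul_mem_right _ _ (Ideal.pow_mem_of_mem _ ?_ _ hp)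
  refine ⟨(l i).comp φ, ?_, by rw [AddMonoidHom.comp_apply, h, hs]⟩
  rw [pow_succ, mul_comm]
  exact comp_mem_integralMaps (hl i) hφ

include hl hb in
/-- If `A` is free over `A ^ p`, every nonzero element of `A` is mapped to `1` by some
`p^{-e}`-linear endomorphism of `A`. -/
theorem exists_integralMap_eq_one [IsDomain A] [IsNoetherianRing A] (hp : 1 < p) (d : A)
    (hd : d ≠ 0) : ∃ e, ∃ φ ∈ integralMaps A K (p ^ e), φ (algebraMap A K d) = 1 := by
  have hmono : Monotone fun e => valueIdeal A K (p ^ e) d :=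
    monotone_nat_of_le_succ fun e => valueIdeal_le_succ b l hl hb (by omega) e d
  obtain ⟨e₀, he₀⟩ := monotone_stabilizes_iff_noetherian.2 ‹_› ⟨_, hmono⟩
  have htop : valueIdeal A K (p ^ e₀) d = ⊤ := by
    by_contra hne
    have hbot := Ideal.iInf_pow_eq_bot_of_isDomain _ hne
    have hmem : d ∈ ⨅ i : ℕ, valueIdeal A K (p ^ e₀) d ^ i := by
      rw [Submodule.mem_iInf]
      intro i
      have h1 := mem_pow_of_forall_map_mem b l hl hb (max e₀ i) (valueIdeal A K (p ^ e₀) d) d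
        fun φ hφ => by
          obtain ⟨a, ha⟩ := hφ.2 d
          refine ⟨a, ?_, ha.symm⟩
          have := he₀ (max e₀ i) (le_max_left _ _)
          simp only [OrderHom.coe_mk] at this
          rw [this]
          exact ⟨φ, hφ, ha.symm⟩
      refine Ideal.pow_le_pow_right ?_ h1
      exact ((le_max_right e₀ i).trans (Nat.lt_pow_self hp).le)
    rw [hbot] at hmem
    exact hd (by simpa using hmem)
  obtain ⟨φ, hφ, h⟩ := (Ideal.eq_top_iff_one _).1 htop
  exact ⟨e₀, φ, hφ, by rw [h, map_one]⟩

end Free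

end TestElement

section FFinite

variable {R K : Type*} [CommRing R] [Field K] [Algebra R K] {p : ℕ} [Fact p.Prime]

theorem iterateFrobenius_finite {R : Type*} [CommRing R] [CharP R p]
    (h : (frobenius R p).Finite) (e : ℕ) :
    (iterateFrobenius R p e).Finite := by
  induction e with
  | zero => rw [iterateFrobenius_zero]; exact RingHom.Finite.id R
  | succ e ih => rw [iterateFrobenius_add, iterateFrobenius_one]; exact ih.comp h

theorem frobenius_fractionField_finite [IsDomain R] [IsFractionRing R K] [CharP R p] [CharP K p]
    (h : (frobenius R p).Finite) :
    (frobenius K p).Finite :=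
  finite_fractionField (frobenius R p) (frobenius K p) (by simp [frobenius_def]) h

/-- A `p^{-e}`-linear endomorphism of `K` becomes integral on `R` after multiplication by a suitable
element of a given multiplicative set that clears the denominators. -/
theorem exists_common_multiple [CharP R p] (h : (frobenius R p).Finite) (e : ℕ) (φ : K →+ K)
    (hφ : ∀ a b, φ (a ^ p ^ e * b) = a * φ b) (M : Submonoid R)
    (hM : ∀ r : R, ∃ m ∈ M, algebraMap R K m * φ (algebraMap R K r) ∈ (algebraMap R K).range) :
    ∃ m ∈ M, (AddMonoidHom.mulLeft (algebraMap R K m)).comp φ ∈ integralMaps R K (p ^ e) := by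
  obtain ⟨n, r, hr⟩ := exists_generators_of_finite _ (iterateFrobenius_finite h e)
  choose m hmM hm using fun j => hM (r j)
  refine ⟨∏ j, m j, prod_mem fun j _ => hmM j, fun a b => ?_, fun x => ?_⟩
  · simp only [AddMonoidHom.comp_apply, AddMonoidHom.coe_mulLeft, hφ]; ring
  · obtain ⟨s, rfl⟩ := hr x
    simp only [AddMonoidHom.comp_apply, AddMonoidHom.coe_mulLeft, map_sum]
    refine sum_mem fun j _ => ?_
    rw [map_mul, iterateFrobenius_def, map_pow, hφ, mul_left_comm]
    refine mul_mem ⟨_, rfl⟩ ?_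
    rw [← Finset.prod_erase_mul _ _ (Finset.mem_univ j), map_mul, mul_assoc]
    exact mul_mem ⟨_, rfl⟩ (hm j)

theorem exists_integralMap_one_eq_sq {c : R} {ψ : K →+ K} (hψ : ψ ∈ integralMaps R K p)
    (hψ1 : ψ 1 = algebraMap R K c) (e : ℕ) :
    ∃ φ ∈ integralMaps R K (p ^ e), φ 1 = algebraMap R K (c ^ 2) := by
  have hp : 2 ≤ p := (Fact.out : p.Prime).two_le
  induction e with
  | zero =>
    refine ⟨_, smul_mem_integralMaps (by simpa using id_mem_integralMaps) (c ^ 2), by simp⟩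
  | succ e ih =>
    obtain ⟨φ, hφ, h⟩ := ih
    refine ⟨(ψ.comp (AddMonoidHom.mulLeft (algebraMap R K (c ^ (p - 2))))).comp φ, ?_, ?_⟩
    · rw [pow_succ, mul_comm]
      exact comp_mem_integralMaps (comp_mulLeft_mem_integralMaps hψ _) hφ
    · simp only [AddMonoidHom.comp_apply, AddMonoidHom.coe_mulLeft, h]
      rw [← map_mul, ← pow_add, Nat.sub_add_cancel hp, map_pow]
      have := hψ.1 (algebraMap R K c) 1
      rw [mul_one] at this
      rw [this, hψ1, sq, map_mul]

/-- A common denominator for the coordinates of `K` over `K ^ p` and a splitting of Frobenius. -/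
theorem exists_denominator [IsDomain R] [IsFractionRing R K] [CharP R p]
    (h : (frobenius R p).Finite) {n : ℕ} (b : Fin n → K) (l : Fin n → K →+ K)
    (hl : ∀ i a x, l i (a ^ p * x) = a * l i x) (ψ : K →+ K) (hψ : ∀ a x, ψ (a ^ p * x) = a * ψ x) :
    ∃ c : R, c ≠ 0 ∧
      (∀ i (r : R), algebraMap R K c * l i (algebraMap R K r) ∈ (algebraMap R K).range) ∧
      (∀ i, algebraMap R K c * b i ∈ (algebraMap R K).range) ∧
      (AddMonoidHom.mulLeft (algebraMap R K c)).comp ψ ∈ integralMaps R K p := by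
  have clear : ∀ φ : K →+ K, (∀ a b, φ (a ^ p * b) = a * φ b) → ∃ m : R, m ≠ 0 ∧
      (AddMonoidHom.mulLeft (algebraMap R K m)).comp φ ∈ integralMaps R K p := by
    intro φ hφ
    obtain ⟨m, hm, h⟩ := exists_common_multiple (K := K) h 1 φ (by simpa using hφ)
      (nonZeroDivisors R) fun r => by
        obtain ⟨m, hm⟩ := IsLocalization.exists_integer_multiple (nonZeroDivisors R)
          (φ (algebraMap R K r))
        exact ⟨m, m.2, by simpa [IsLocalization.IsInteger, Algebra.smul_def] using hm⟩
    exact ⟨m, nonZeroDivisors.ne_zero hm, by simpa using h⟩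
  choose m hm0 hm using fun i => clear (l i) (hl i)
  obtain ⟨m', hm'0, hm'⟩ := clear ψ hψ
  choose k hk using fun i => IsLocalization.exists_integer_multiple (nonZeroDivisors R) (b i)
  have hkmem : ∀ i, algebraMap R K (k i) * b i ∈ (algebraMap R K).range := fun i => by
    simpa [IsLocalization.IsInteger, Algebra.smul_def] using hk i
  refine ⟨m' * (∏ i, m i) * ∏ i, (k i : R), mul_ne_zero (mul_ne_zero hm'0
    (Finset.prod_ne_zero_iff.2 fun i _ => hm0 i))
    (Finset.prod_ne_zero_iff.2 fun i _ => nonZeroDivisors.ne_zero (k i).2), fun i r => ?_,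
    fun i => ?_, ?_⟩
  · obtain ⟨d, hd⟩ := Finset.dvd_prod_of_mem m (Finset.mem_univ i)
    have := (smul_mem_integralMaps (hm i) (m' * d * ∏ i, (k i : R))).2 r
    simp only [AddMonoidHom.comp_apply, AddMonoidHom.coe_mulLeft, ← mul_assoc, ← map_mul] at this
    convert this using 3
    rw [hd]
    ring
  · obtain ⟨d, hd⟩ := Finset.dvd_prod_of_mem (fun i => (k i : R)) (Finset.mem_univ i)
    rw [hd, mul_comm (k i : R) d, ← mul_assoc, map_mul, mul_assoc]
    exact mul_mem ⟨_, rfl⟩ (hkmem i)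
  · convert smul_mem_integralMaps hm' ((∏ i, m i) * ∏ i, (k i : R)) using 1
    ext x
    simp only [AddMonoidHom.comp_apply, AddMonoidHom.coe_mulLeft, map_mul]
    ring

/-- Existence of test elements: some nonzero `c` is a value of a `p^{-e}`-linear endomorphism of `R`
at every nonzero element `d`. -/
theorem exists_testElement [IsDomain R] [IsFractionRing R K] [IsNoetherianRing R] [CharP R p]
    (h : (frobenius R p).Finite) :
    ∃ c : R, c ≠ 0 ∧ ∀ d : R, d ≠ 0 →
      ∃ e, ∃ φ ∈ integralMaps R K (p ^ e), φ (algebraMap R K d) = algebraMap R K c := by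
  have hinj := IsFractionRing.injective R K
  have : CharP K p := charP_of_injective_algebraMap hinj p
  have hp : 1 < p := (Fact.out : p.Prime).one_lt
  have hK := frobenius_fractionField_finite (K := K) h
  obtain ⟨n, b, l, hl, hb⟩ := exists_coordinates _ hK
  obtain ⟨ψ, hψ, hψ1⟩ := exists_functional_ne_zero _ hK
  simp only [frobenius_def] at hl hb hψ
  obtain ⟨c, hc0, hcl, hcb, hcψ⟩ := exists_denominator h b l hl ψ hψ
  let A := Localization.Away c
  have hpow : Submonoid.powers c ≤ nonZeroDivisors R :=
    powers_le_nonZeroDivisors_of_noZeroDivisors hc0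
  have : IsDomain A := IsLocalization.isDomain_localization hpow
  have : IsNoetherianRing A := IsLocalization.isNoetherianRing (Submonoid.powers c) A inferInstance
  have hunit : IsUnit (algebraMap R K c) := by simpa using hc0
  let : Algebra A K := (IsLocalization.Away.lift (S := A) c hunit).toAlgebra
  have hAR : ∀ r : R, algebraMap A K (algebraMap R A r) = algebraMap R K r := fun r => by
    rw [RingHom.algebraMap_toAlgebra]
    exact IsLocalization.Away.lift_eq c hunit r
  have hA : ∀ x : K, x ∈ (algebraMap A K).range ↔
      ∃ i : ℕ, algebraMap R K (c ^ i) * x ∈ (algebraMap R K).range := by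
    intro x
    constructor
    · rintro ⟨a, rfl⟩
      obtain ⟨i, r, hir⟩ := IsLocalization.Away.surj c a
      refine ⟨i, r, ?_⟩
      rw [← hAR, ← hAR, ← map_mul, ← hir, mul_comm, map_pow]
    · rintro ⟨i, r, hr⟩
      refine ⟨algebraMap R A r * IsLocalization.Away.invSelf c ^ i, ?_⟩
      have h1 : algebraMap A K (IsLocalization.Away.invSelf c) * algebraMap R K c = 1 := by
        rw [← hAR, ← map_mul, mul_comm, IsLocalization.Away.mul_invSelf, map_one]
      rw [map_mul, hAR, hr, map_pow, map_pow]
      calc _ = x * (algebraMap A K (IsLocalization.Away.invSelf c) * algebraMap R K c) ^ i := by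
            ring
        _ = x := by rw [h1, one_pow, mul_one]
  have hAinj : Function.Injective (algebraMap A K) := by
    rw [injective_iff_map_eq_zero]
    intro a ha
    obtain ⟨i, r, hir⟩ := IsLocalization.Away.surj c a
    have h1 : algebraMap R K r = 0 := by rw [← hAR, ← hir, map_mul, ha, zero_mul]
    have h2 : r = 0 := hinj (by simpa using h1)
    rw [h2, map_zero] at hir
    refine (mul_eq_zero.1 hir).resolve_right ?_
    exact ((IsLocalization.Away.algebraMap_isUnit c).pow i).ne_zero
  have : FaithfulSMul A K := (faithfulSMul_iff_algebraMap_injective A K).2 hAinj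
  have hlA : ∀ i, l i ∈ integralMaps A K p := by
    refine fun i => ⟨hl i, fun a => ?_⟩
    obtain ⟨j, r, hjr⟩ := IsLocalization.Away.surj c a
    have h1 : algebraMap A K a * algebraMap R K c ^ j = algebraMap R K r := by
      rw [← hAR r, ← hjr, map_mul, map_pow, hAR]
    have h2 : (algebraMap R K c ^ j) ^ p * algebraMap A K a =
        algebraMap R K (c ^ (j * (p - 1)) * r) := by
      rw [map_mul, ← h1, map_pow, mul_left_comm, ← pow_add, ← pow_mul, mul_comm]
      congr 2
      obtain ⟨q, rfl⟩ := Nat.exists_eq_add_of_lt hp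
      simp
      ring
    rw [hA]
    refine ⟨j + 1, ?_⟩
    rw [pow_succ', map_mul, mul_assoc, map_pow, ← hl, h2]
    exact hcl i _
  choose b' hb' using fun i => (hA (b i)).2 ⟨1, by simpa using hcb i⟩
  have hc3 : c ^ 3 ≠ 0 := pow_ne_zero _ hc0
  refine ⟨c ^ 3, hc3, fun d hd => ?_⟩
  obtain ⟨e, φ, hφ, hφd⟩ := exists_integralMap_eq_one b' l hlA (by simpa only [hb'] using hb) hp
    (algebraMap R A d) (by
      intro h0
      have := hAR d
      rw [h0, map_zero] at this
      exact hd (hinj (by simpa using this.symm)))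
  rw [hAR] at hφd
  obtain ⟨_, ⟨j, rfl⟩, hj⟩ := exists_common_multiple h e φ hφ.1 (Submonoid.powers c) fun r => by
    have := hφ.2 (algebraMap R A r)
    rw [hAR, hA] at this
    obtain ⟨i, hi⟩ := this
    exact ⟨c ^ i, ⟨i, rfl⟩, hi⟩
  obtain ⟨χ, hχ, hχ1⟩ := exists_integralMap_one_eq_sq (c := c) hcψ (by simp [hψ1]) j
  have hjp : j ≤ p ^ j := (Nat.lt_pow_self hp).le
  refine ⟨j + e, _, by
    rw [pow_add]
    exact comp_mem_integralMaps (comp_mulLeft_mem_integralMaps hχ (c ^ (p ^ j - j))) hj, ?_⟩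
  simp only [AddMonoidHom.comp_apply, AddMonoidHom.coe_mulLeft, hφd, mul_one]
  rw [← map_mul, ← pow_add, Nat.sub_add_cancel hjp, map_pow]
  have := hχ.1 (algebraMap R K c) 1
  rw [mul_one] at this
  rw [this, hχ1, ← map_mul]
  ring_nf

end FFinite

section Orders

variable {K α : Type*} [Field K]

/-- `v f x` is the order of vanishing of `f` at `x`, for the points `x` of `P`. -/
structure IsOrder (P : Set α) (v : K → α → ℤ) : Prop where
  map_mul : ∀ {f g : K}, f ≠ 0 → g ≠ 0 → ∀ x ∈ P, v (f * g) x = v f x + v g x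
  map_add : ∀ {f g : K}, f ≠ 0 → g ≠ 0 → f + g ≠ 0 → ∀ x ∈ P, min (v f x) (v g x) ≤ v (f + g) x

/-- The elements `f` of `K` with `f = 0` or `div f + D ≥ 0` on `P`. -/
def secs (P : Set α) (v : K → α → ℤ) (D : α → ℤ) : Set K :=
  {f | f ≠ 0 → ∀ x ∈ P, 0 ≤ v f x + D x}

variable {P P' : Set α} {v : K → α → ℤ} {D E : α → ℤ}

theorem zero_mem_secs : (0 : K) ∈ secs P v D := fun h => absurd rfl h

theorem secs_mono (hP : P' ⊆ P) (h : ∀ x ∈ P', D x ≤ E x) : secs P v D ⊆ secs P' v E := by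
  intro f hf h0 x hx
  have := hf h0 x (hP hx)
  have := h x hx
  omega

theorem mem_secs_iff_forall {f : K} : f ∈ secs P v D ↔ ∀ x ∈ P, f ∈ secs {x} v D := by
  constructor
  · intro h x hx h0 y hy
    obtain rfl := hy
    exact h h0 _ hx
  · intro h h0 x hx
    exact h x hx h0 x rfl

theorem mem_secs_singleton {f : K} {x : α} : f ∈ secs {x} v D ↔ (f ≠ 0 → 0 ≤ v f x + D x) := by
  constructor
  · intro h h0
    exact h h0 x rfl
  · rintro h h0 _ rfl
    exact h h0

namespace IsOrder

variable (hv : IsOrder P v)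
include hv

theorem mono (h : P' ⊆ P) : IsOrder P' v :=
  ⟨fun hf hg x hx => hv.map_mul hf hg x (h hx), fun hf hg h0 x hx => hv.map_add hf hg h0 x (h hx)⟩

theorem map_one {x : α} (hx : x ∈ P) : v 1 x = 0 := by
  have := hv.map_mul (one_ne_zero (α := K)) one_ne_zero x hx
  rw [mul_one] at this
  omega

theorem map_inv {f : K} (hf : f ≠ 0) {x : α} (hx : x ∈ P) : v f⁻¹ x = -v f x := by
  have := hv.map_mul hf (inv_ne_zero hf) x hx
  rw [mul_inv_cancel₀ hf, hv.map_one hx] at this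
  omega

theorem map_pow {f : K} (hf : f ≠ 0) (n : ℕ) {x : α} (hx : x ∈ P) : v (f ^ n) x = n * v f x := by
  induction n with
  | zero => simp [hv.map_one hx]
  | succ n ih => rw [pow_succ, hv.map_mul (pow_ne_zero n hf) hf x hx, ih]; push_cast; ring

theorem map_zpow {f : K} (hf : f ≠ 0) (n : ℤ) {x : α} (hx : x ∈ P) : v (f ^ n) x = n * v f x := by
  obtain ⟨m, rfl | rfl⟩ := n.eq_nat_or_neg
  · rw [zpow_natCast, hv.map_pow hf _ hx]
  · rw [zpow_neg, zpow_natCast, hv.map_inv (pow_ne_zero _ hf) hx, hv.map_pow hf _ hx]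
    ring

theorem map_neg (f : K) {x : α} (hx : x ∈ P) : v (-f) x = v f x := by
  by_cases hf : f = 0
  · simp [hf]
  have h1 : v (-1) x = 0 := by
    have := hv.map_mul (f := (-1 : K)) (g := -1) (by simp) (by simp) x hx
    rw [neg_one_mul, neg_neg, hv.map_one hx] at this
    omega
  have := hv.map_mul (f := (-1 : K)) (g := f) (by simp) hf x hx
  rw [neg_one_mul, h1] at this
  omega

theorem add_mem {f g : K} (hf : f ∈ secs P v D) (hg : g ∈ secs P v D) : f + g ∈ secs P v D := by
  by_cases hf0 : f = 0
  · simpa [hf0] using hg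
  by_cases hg0 : g = 0
  · simpa [hg0] using hf
  intro h0 x hx
  have h1 := hv.map_add hf0 hg0 h0 x hx
  have h2 := hf hf0 x hx
  have h3 := hg hg0 x hx
  rcases min_le_iff.1 h1 with h | h <;> omega

theorem sum_mem {ι : Type*} (s : Finset ι) (f : ι → K) (h : ∀ i ∈ s, f i ∈ secs P v D) :
    ∑ i ∈ s, f i ∈ secs P v D := by
  classical
  induction s using Finset.induction_on with
  | empty => simpa using zero_mem_secs
  | insert i s hi ih =>
    rw [Finset.sum_insert hi]
    exact hv.add_mem (h i (by simp)) (ih fun j hj => h j (by simp [hj]))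

theorem mul_mem {f g : K} (hf : f ∈ secs P v D) (hg : g ∈ secs P v E) :
    f * g ∈ secs P v (fun x => D x + E x) := by
  intro h0 x hx
  have hf0 := left_ne_zero_of_mul h0
  have hg0 := right_ne_zero_of_mul h0
  have h2 := hf hf0 x hx
  have h3 := hg hg0 x hx
  rw [hv.map_mul hf0 hg0 x hx]
  dsimp only
  omega

theorem mul_mem_iff {t f : K} (ht : t ≠ 0) :
    t * f ∈ secs P v D ↔ f ∈ secs P v (fun x => D x + v t x) := by
  by_cases hf : f = 0
  · simp [hf, zero_mem_secs]
  have h : ∀ x ∈ P, v (t * f) x + D x = v f x + (D x + v t x) := fun x hx => by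
    rw [hv.map_mul ht hf x hx]; ring
  constructor
  · intro h' h0 x hx
    have := h' (mul_ne_zero ht hf) x hx
    have := h x hx
    dsimp only
    omega
  · intro h' h0 x hx
    have h1 := h' hf x hx
    have := h x hx
    dsimp only at h1
    omega

/-- If the order of `f` at `x` is smaller than that of `g`, then `f + g` has the order of `f`. -/
theorem map_add_eq {f g : K} (hf : f ≠ 0) {x : α} (hx : x ∈ P)
    (hg : g ∈ secs {x} v (fun _ => -v f x - 1)) : f + g ≠ 0 ∧ v (f + g) x = v f x := by
  have hvx := hv.mono (Set.singleton_subset_iff.2 hx)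
  rw [mem_secs_singleton] at hg
  by_cases hg0 : g = 0
  · simp [hg0, hf]
  have h1 := hg hg0
  have h0 : f + g ≠ 0 := by
    intro h
    have : g = -f := by linear_combination h
    rw [this, hv.map_neg f hx] at h1
    omega
  refine ⟨h0, le_antisymm ?_ ?_⟩
  · by_contra! hlt
    have h2 : f = (f + g) + -g := by ring
    have h3 := hv.map_add h0 (neg_ne_zero.2 hg0) (by rwa [← h2]) x hx
    rw [← h2, hv.map_neg g hx] at h3
    rcases min_le_iff.1 h3 with h | h <;> omega
  · have h3 := hv.map_add hf hg0 h0 x hx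
    rcases min_le_iff.1 h3 with h | h <;> omega

end IsOrder

variable {R : Type*} [CommRing R] [Algebra R K]

/-- The properties of the orders of vanishing of rational functions at the prime divisors `P` of a
normal Noetherian affine scheme `Spec R` with function field `K`. -/
structure DivisorialData (R : Type*) [CommRing R] [Algebra R K] (P : Set α) (v : K → α → ℤ) : Prop
    extends IsOrder P v where
  mem_range_iff : ∀ f : K, f ∈ (algebraMap R K).range ↔ f ∈ secs P v 0
  finite_support : ∀ f : K, f ≠ 0 → {x ∈ P | v f x ≠ 0}.Finite
  exists_uniformizer : ∀ x ∈ P, ∃ f : K, f ≠ 0 ∧ v f x = 1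
  exists_separating : ∀ x ∈ P, ∀ F : Finset α, (F : Set α) ⊆ P → x ∉ F → ∀ n : ℕ, ∃ s : R,
    algebraMap R K s ≠ 0 ∧ v (algebraMap R K s) x = 0 ∧
      ∀ y ∈ F, (n : ℤ) ≤ v (algebraMap R K s) y

namespace DivisorialData

variable (h : DivisorialData R P v)
include h

theorem algebraMap_mem (r : R) : algebraMap R K r ∈ secs P v 0 := (h.mem_range_iff _).1 ⟨r, rfl⟩

theorem algebraMap_mul_mem {D : α → ℤ} {f : K} (hf : f ∈ secs P v D) (r : R) :
    algebraMap R K r * f ∈ secs P v D := by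
  simpa using h.mul_mem (h.algebraMap_mem r) hf

theorem order_nonneg {r : R} (hr : algebraMap R K r ≠ 0) {x : α} (hx : x ∈ P) :
    0 ≤ v (algebraMap R K r) x := by
  simpa using h.algebraMap_mem r hr x hx

theorem exists_order_eq {x : α} (hx : x ∈ P) (m : ℤ) : ∃ f : K, f ≠ 0 ∧ v f x = m := by
  obtain ⟨f, hf, h1⟩ := h.exists_uniformizer x hx
  exact ⟨f ^ m, zpow_ne_zero _ hf, by rw [h.map_zpow hf m hx, h1, mul_one]⟩

theorem exists_separating_of_bound {x : α} (hx : x ∈ P) (B : α → ℤ)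
    (hB : {y ∈ P | B y ≠ 0}.Finite) :
    ∃ s : R, algebraMap R K s ≠ 0 ∧ v (algebraMap R K s) x = 0 ∧
      ∀ y ∈ P, y ≠ x → B y ≤ v (algebraMap R K s) y := by
  classical
  obtain ⟨s, hs, hsx, hsF⟩ := h.exists_separating x hx (hB.toFinset.erase x)
    (fun y hy => (hB.mem_toFinset.1 (Finset.mem_of_mem_erase hy)).1) (by simp)
    (∑ y ∈ hB.toFinset, (B y).natAbs)
  refine ⟨s, hs, hsx, fun y hy hyx => ?_⟩
  by_cases hBy : B y = 0
  · rw [hBy]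
    exact h.order_nonneg hs hy
  · have hy' : y ∈ hB.toFinset := by simp [hy, hBy]
    refine le_trans ?_ (hsF y (by simp [hyx, hy, hBy]))
    have := Finset.single_le_sum (f := fun y => (B y).natAbs) (fun _ _ => Nat.zero_le _) hy'
    omega

/-- Approximation: the order at one point is prescribed, at the other points it is bounded below. -/
theorem exists_approx {x : α} (hx : x ∈ P) (m : ℤ) (B : α → ℤ) (hB : {y ∈ P | B y ≠ 0}.Finite) :
    ∃ f : K, f ≠ 0 ∧ v f x = m ∧ ∀ y ∈ P, y ≠ x → B y ≤ v f y := by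
  obtain ⟨f, hf, hfx⟩ := h.exists_order_eq hx m
  obtain ⟨s, hs, hsx, hsB⟩ := h.exists_separating_of_bound hx (fun y => B y - v f y)
    ((hB.union (h.finite_support f hf)).subset fun y hy => by
      simp only [Set.mem_ofPred_eq, Set.mem_union] at hy ⊢
      by_contra! hc
      have := hc.1 hy.1
      have := hc.2 hy.1
      exact hy.2 (by omega))
  refine ⟨algebraMap R K s * f, mul_ne_zero hs hf, ?_, fun y hy hyx => ?_⟩
  · rw [h.map_mul hs hf x hx]; omega
  · rw [h.map_mul hs hf y hy]
    have := hsB y hy hyx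
    omega

theorem exists_bound (B : α → ℤ) (hB : {y ∈ P | B y ≠ 0}.Finite) :
    ∃ r : R, algebraMap R K r ≠ 0 ∧ ∀ y ∈ P, B y ≤ v (algebraMap R K r) y := by
  have hB' : {y ∈ P | max (B y) 0 ≠ 0}.Finite := hB.subset fun y hy => by
    simp only [Set.mem_ofPred_eq] at hy ⊢
    exact ⟨hy.1, fun h0 => hy.2 (by simp [h0])⟩
  obtain ⟨f, hf, hfB⟩ : ∃ f : K, f ≠ 0 ∧ ∀ y ∈ P, max (B y) 0 ≤ v f y := by
    rcases P.eq_empty_or_nonempty with rfl | ⟨x, hx⟩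
    · exact ⟨1, one_ne_zero, by simp⟩
    · obtain ⟨f, hf, hfx, hfB⟩ := h.exists_approx hx (max (B x) 0) _ hB'
      refine ⟨f, hf, fun y hy => ?_⟩
      by_cases hyx : y = x
      · rw [hyx, hfx]
      · exact hfB y hy hyx
  obtain ⟨r, rfl⟩ := (h.mem_range_iff f).2 fun _ y hy => by
    have := (le_max_right _ _).trans (hfB y hy)
    simpa using this
  exact ⟨r, hf, fun y hy => (le_max_left _ _).trans (hfB y hy)⟩

/-- A section of `𝒪(D)` at `x` is a global section up to a function that is invertible at `x`. -/
theorem exists_mul_mem {x : α} (hx : x ∈ P) (D : α → ℤ) (hD : {y ∈ P | D y ≠ 0}.Finite) {f : K}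
    (hf : f ∈ secs {x} v D) : ∃ s : R, algebraMap R K s ≠ 0 ∧ v (algebraMap R K s) x = 0 ∧
      algebraMap R K s * f ∈ secs P v D := by
  by_cases hf0 : f = 0
  · exact ⟨1, by simp, by simp [h.map_one hx], by simpa [hf0] using zero_mem_secs⟩
  obtain ⟨s, hs, hsx, hsB⟩ := h.exists_separating_of_bound hx (fun y => -D y - v f y)
    ((hD.union (h.finite_support f hf0)).subset fun y hy => by
      simp only [Set.mem_ofPred_eq, Set.mem_union] at hy ⊢
      by_contra! hc
      have := hc.1 hy.1
      have := hc.2 hy.1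
      exact hy.2 (by omega))
  refine ⟨s, hs, hsx, fun _ y hy => ?_⟩
  rw [h.map_mul hs hf0 y hy]
  by_cases hyx : y = x
  · subst hyx
    have := mem_secs_singleton.1 hf hf0
    omega
  · have := hsB y hy hyx
    omega

theorem le_of_secs_subset (D E : α → ℤ) (hD : {y ∈ P | D y ≠ 0}.Finite)
    (hDE : secs P v D ⊆ secs P v E) : ∀ x ∈ P, D x ≤ E x := by
  intro x hx
  obtain ⟨f, hf, hfx, hfD⟩ := h.exists_approx hx (-D x) (fun y => -D y) (by simpa using hD)
  have := hDE (fun _ y hy => by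
    by_cases hyx : y = x
    · subst hyx; omega
    · have := hfD y hy hyx; omega) hf x hx
  omega

end DivisorialData

end Orders

section Finite

variable {R S K L α β : Type*} [CommRing R] [CommRing S] [Field K] [Field L]
  [Algebra R K] [Algebra S L]

/-- The orders of vanishing for a finite extension `R → S` of normal domains with fraction fields
`K → L`; here `π` maps the prime divisors `Q` of `S` to the prime divisors `P` of `R`, and `e` is
the ramification index. -/
structure FiniteData (σ : R →+* S) (τ : K →+* L) (P : Set α) (v : K → α → ℤ) (Q : Set β)
    (w : L → β → ℤ) (π : β → α) (e : β → ℕ) : Prop where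
  base : DivisorialData R P v
  top : DivisorialData S Q w
  finite : σ.Finite
  comm : ∀ r, τ (algebraMap R K r) = algebraMap S L (σ r)
  mapsTo : ∀ y ∈ Q, π y ∈ P
  exists_over : ∀ x ∈ P, ∃ y ∈ Q, π y = x
  finite_fiber : ∀ x ∈ P, (Q ∩ π ⁻¹' {x}).Finite
  ram_pos : ∀ y ∈ Q, 0 < e y
  order_map : ∀ y ∈ Q, ∀ f : K, f ≠ 0 → w (τ f) y = e y * v f (π y)

/-- The dual, with respect to the pairing `T (b * g)`, of the semilocal ring of the functions that
are regular along `F`; the values are taken in the local ring at `x`. -/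
def localDual (F : Set β) (w : L → β → ℤ) (x : α) (v : K → α → ℤ) (T : L →+ K) : Set L :=
  {g | ∀ b ∈ secs F w 0, T (b * g) ∈ secs {x} v 0}

/-- The coefficient at `y` of the divisor of `T`. -/
noncomputable def dualOrder (F : Set β) (w : L → β → ℤ) (x : α) (v : K → α → ℤ) (T : L →+ K)
    (y : β) : ℤ :=
  -sInf ((fun g => w g y) '' {g ∈ localDual F w x v T | g ≠ 0})

variable {σ : R →+* S} {τ : K →+* L} {P : Set α} {v : K → α → ℤ} {Q : Set β}
  {w : L → β → ℤ} {π : β → α} {e : β → ℕ}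

namespace FiniteData

variable (h : FiniteData σ τ P v Q w π e)
include h

theorem isOrder_fiber (x : α) : IsOrder (Q ∩ π ⁻¹' {x}) w :=
  h.top.toIsOrder.mono Set.inter_subset_left

theorem isOrder_singleton {x : α} (hx : x ∈ P) : IsOrder {x} v :=
  h.base.toIsOrder.mono (Set.singleton_subset_iff.2 hx)

theorem finite_pullback {A : Type*} [Zero A] {B : α → A} (hB : {x ∈ P | B x ≠ 0}.Finite) :
    {y ∈ Q | B (π y) ≠ 0}.Finite := by
  refine (hB.biUnion fun x hx => h.finite_fiber x hx.1).subset fun y hy => ?_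
  simp only [Set.mem_iUnion]
  exact ⟨π y, ⟨h.mapsTo y hy.1, hy.2⟩, hy.1, rfl⟩

/-- A section of `𝒪(D)` along the fiber of `x` is a global section up to a function on the base that
is invertible at `x`. -/
theorem exists_mul_mem {x : α} (hx : x ∈ P) {b : L}
    (hb : b ∈ secs (Q ∩ π ⁻¹' {x}) w 0) : ∃ s : R, algebraMap R K s ≠ 0 ∧
      v (algebraMap R K s) x = 0 ∧ τ (algebraMap R K s) * b ∈ (algebraMap S L).range := by
  classical
  by_cases hb0 : b = 0
  · exact ⟨1, by simp, by simp [h.base.map_one hx], by simp [hb0]⟩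
  have hfin := h.top.finite_support b hb0
  obtain ⟨s, hs, hsx, hsB⟩ := h.base.exists_separating_of_bound hx
    (fun x => ∑ y ∈ hfin.toFinset, if π y = x then |w b y| else 0)
    ((hfin.image π).subset fun x hx' => by
      obtain ⟨y, hy, hy'⟩ := Finset.exists_ne_zero_of_sum_ne_zero hx'.2
      exact ⟨y, by simpa using hy, by by_contra hc; exact hy' (if_neg hc)⟩)
  refine ⟨s, hs, hsx, (h.top.mem_range_iff _).2 fun _ y hy => ?_⟩
  have hs' : τ (algebraMap R K s) ≠ 0 := by simpa using hs
  rw [h.top.map_mul hs' hb0 y hy, h.order_map y hy _ hs, Pi.zero_apply, add_zero]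
  have hpos := h.base.order_nonneg hs (h.mapsTo y hy)
  by_cases hyx : π y = x
  · have := hb hb0 y ⟨hy, hyx⟩
    rw [Pi.zero_apply, add_zero] at this
    positivity
  · by_cases hwy : w b y = 0
    · rw [hwy, add_zero]
      positivity
    · have h1 := hsB (π y) (h.mapsTo y hy) hyx
      have h2 := Finset.single_le_sum (f := fun z => if π z = π y then |w b z| else 0)
        (fun z _ => by split_ifs <;> positivity) (hfin.mem_toFinset.2 ⟨hy, hwy⟩)
      simp only [if_true] at h2
      have h3 : (1 : ℤ) ≤ e y := by exact_mod_cast h.ram_pos y hy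
      nlinarith [neg_abs_le (w b y)]

section Dual

variable (T : L →+ K)

theorem mul_mem_localDual {x : α} {g b : L} (hb : b ∈ secs (Q ∩ π ⁻¹' {x}) w 0)
    (hg : g ∈ localDual (Q ∩ π ⁻¹' {x}) w x v T) :
    b * g ∈ localDual (Q ∩ π ⁻¹' {x}) w x v T := by
  intro c hc
  rw [← mul_assoc]
  exact hg _ ((h.isOrder_fiber x).mul_mem hc hb)

variable {T}
variable (hT : ∀ a b, T (τ a * b) = a * T b)
include hT

/-- The functionals `T (· * g)` with values in `𝒪(E)` can be recognized at the prime divisors. -/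
theorem forall_map_mem_iff (E : α → ℤ) (g : L) :
    (∀ s : S, T (algebraMap S L s * g) ∈ secs P v E) ↔
      ∀ x ∈ P, ∀ b ∈ secs (Q ∩ π ⁻¹' {x}) w 0, T (b * g) ∈ secs {x} v E := by
  constructor
  · intro hg x hx b hb
    obtain ⟨s, hs, hsx, c, hc⟩ := h.exists_mul_mem hx hb
    have h1 := mem_secs_iff_forall.1 (hg c) x hx
    rw [hc, mul_assoc, hT, (h.isOrder_singleton hx).mul_mem_iff hs] at h1
    refine secs_mono le_rfl ?_ h1
    rintro _ rfl
    simp [hsx]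
  · intro hg s
    rw [mem_secs_iff_forall]
    intro x hx
    exact hg x hx _ (secs_mono Set.inter_subset_left (fun _ _ => le_rfl) (h.top.algebraMap_mem s))

variable [IsDomain R] [IsFractionRing R K]

theorem exists_mem_localDual : ∃ r : R, algebraMap R K r ≠ 0 ∧
    ∀ x ∈ P, τ (algebraMap R K r) ∈ localDual (Q ∩ π ⁻¹' {x}) w x v T := by
  classical
  obtain ⟨n, b, hb⟩ := exists_generators_of_finite σ h.finite
  obtain ⟨r, hr⟩ := IsLocalization.exist_integer_multiples_of_finset (nonZeroDivisors R)
    (Finset.univ.image fun j => T (algebraMap S L (b j)))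
  refine ⟨r, by simp, ?_⟩
  refine (h.forall_map_mem_iff hT 0 _).1 fun s => ?_
  obtain ⟨c, rfl⟩ := hb s
  rw [← h.base.mem_range_iff, mul_comm, hT, map_sum, map_sum, Finset.mul_sum]
  refine sum_mem fun j _ => ?_
  rw [map_mul, ← h.comm, hT, mul_left_comm]
  refine mul_mem ⟨_, rfl⟩ ?_
  have := hr (T (algebraMap S L (b j))) (by simp)
  simpa [IsLocalization.IsInteger, Algebra.smul_def] using this

variable [IsDomain S] [IsFractionRing S L]

theorem exists_dual_coordinates (hT0 : T ≠ 0) : ∃ (n : ℕ) (b : Fin n → S) (γ : Fin n → L),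
    ∀ g : L, g = ∑ i, τ (T (algebraMap S L (b i) * g)) * γ i := by
  have hτ := finite_fractionField σ τ h.comm h.finite
  obtain ⟨n, b, l, hl, hb⟩ := exists_coordinates τ hτ
  have hden : ∀ x : L, ∃ r : R, r ≠ 0 ∧ τ (algebraMap R K r) * x ∈ (algebraMap S L).range := by
    intro x
    obtain ⟨a, d, hd, rfl⟩ := IsFractionRing.div_surjective (A := S) x
    have hd0 := nonZeroDivisors.ne_zero hd
    obtain ⟨r, hr, c, hc⟩ := exists_ne_zero_dvd_of_finite σ h.finite hd0
    refine ⟨r, hr, c * a, ?_⟩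
    have : algebraMap S L d ≠ 0 := by simpa using hd0
    rw [h.comm, hc, map_mul, map_mul]
    field_simp
  choose r hr0 c hc using fun i => hden (b i)
  have hrK : ∀ i, algebraMap R K (r i) ≠ 0 := fun i => by simpa using hr0 i
  choose γ hγ using fun i => exists_eq_functional_mul τ hτ T (l i) hT (hl i) hT0
  refine ⟨n, c, fun i => τ (algebraMap R K (r i))⁻¹ * γ i, fun g => ?_⟩
  refine functional_mul_injective hT0 fun x => ?_
  have h1 : x = ∑ i, τ (T (x * γ i)) * b i := by simpa only [hγ] using hb x
  have h2 : ∀ i, b i = τ (algebraMap R K (r i))⁻¹ * algebraMap S L (c i) := fun i => by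
    rw [hc, ← mul_assoc, ← map_mul, inv_mul_cancel₀ (hrK i), map_one, one_mul]
  conv_lhs => rw [h1, Finset.sum_mul, map_sum]
  rw [Finset.mul_sum, map_sum]
  refine Finset.sum_congr rfl fun i _ => ?_
  rw [mul_assoc, hT, h2 i, mul_assoc, hT]
  have : x * (τ (T (algebraMap S L (c i) * g)) * (τ (algebraMap R K (r i))⁻¹ * γ i)) =
    τ (T (algebraMap S L (c i) * g)) * (τ (algebraMap R K (r i))⁻¹ * (x * γ i)) := by ring
  rw [this, hT, hT]
  ring

theorem exists_lower_bound (hT0 : T ≠ 0) : ∃ B : β → ℤ, {y ∈ Q | B y ≠ 0}.Finite ∧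
    ∀ y ∈ Q, ∀ g ∈ localDual (Q ∩ π ⁻¹' {π y}) w (π y) v T, g ≠ 0 → B y ≤ w g y := by
  classical
  obtain ⟨n, b, γ, hγ⟩ := h.exists_dual_coordinates hT hT0
  refine ⟨fun y => -∑ i, if γ i = 0 then 0 else |w (γ i) y|, ?_, fun y hy g hg hg0 => ?_⟩
  · refine (Set.finite_iUnion fun i : {i : Fin n // γ i ≠ 0} =>
      h.top.finite_support (γ i) i.2).subset fun y hy => ?_
    obtain ⟨i, -, hi⟩ := Finset.exists_ne_zero_of_sum_ne_zero (neg_ne_zero.1 hy.2)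
    rw [Set.mem_iUnion]
    by_cases hγi : γ i = 0
    · simp [hγi] at hi
    · refine ⟨⟨i, hγi⟩, hy.1, fun h0 => hi ?_⟩
      simp [h0]
  · have hwy := h.top.toIsOrder.mono (Set.singleton_subset_iff.2 hy)
    set D : β → ℤ := fun y => ∑ i, if γ i = 0 then 0 else |w (γ i) y| with hD
    have hmem : g ∈ secs {y} w D := by
      rw [hγ g]
      refine hwy.sum_mem _ _ fun i _ => ?_
      rw [mem_secs_singleton]
      intro h0
      have hk0 : T (algebraMap S L (b i) * g) ≠ 0 := by
        intro h1
        simp [h1] at h0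
      have hγ0 : γ i ≠ 0 := right_ne_zero_of_mul h0
      have h1 := hg _ (secs_mono (E := 0) Set.inter_subset_left (fun _ _ => le_rfl)
        (h.top.algebraMap_mem (b i)))
      have h2 := mem_secs_singleton.1 h1 hk0
      rw [Pi.zero_apply, add_zero] at h2
      rw [h.top.map_mul (by simpa using hk0) hγ0 y hy, h.order_map y hy _ hk0]
      have h3 := Finset.single_le_sum (f := fun i => if γ i = 0 then 0 else |w (γ i) y|)
        (fun z _ => by split_ifs <;> positivity) (Finset.mem_univ i)
      simp only [hγ0, if_false] at h3
      have h4 := neg_abs_le (w (γ i) y)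
      have h5 : (0 : ℤ) ≤ e y * v (T (algebraMap S L (b i) * g)) (π y) := by positivity
      rw [hD]
      dsimp only
      omega
    have := mem_secs_singleton.1 hmem hg0
    change -D y ≤ w g y
    omega

theorem dualOrder_spec (hT0 : T ≠ 0) {y : β} (hy : y ∈ Q) :
    (∃ g ∈ localDual (Q ∩ π ⁻¹' {π y}) w (π y) v T, g ≠ 0 ∧
        w g y = -dualOrder (Q ∩ π ⁻¹' {π y}) w (π y) v T y) ∧
      ∀ g ∈ localDual (Q ∩ π ⁻¹' {π y}) w (π y) v T, g ≠ 0 →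
        -dualOrder (Q ∩ π ⁻¹' {π y}) w (π y) v T y ≤ w g y := by
  obtain ⟨B, -, hB⟩ := h.exists_lower_bound hT hT0
  obtain ⟨r, hr, hrd⟩ := h.exists_mem_localDual hT
  set s : Set ℤ := (fun g => w g y) '' {g ∈ localDual (Q ∩ π ⁻¹' {π y}) w (π y) v T | g ≠ 0}
  have hbdd : BddBelow s := by
    refine ⟨B y, ?_⟩
    rintro _ ⟨g, hg, rfl⟩
    exact hB y hy g hg.1 hg.2
  have hne : s.Nonempty := ⟨_, _, ⟨hrd _ (h.mapsTo y hy), by simpa using hr⟩, rfl⟩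
  have hs : -dualOrder (Q ∩ π ⁻¹' {π y}) w (π y) v T y = sInf s := neg_neg _
  rw [hs]
  constructor
  · obtain ⟨g, hg, hgs⟩ := Int.csInf_mem hne hbdd
    exact ⟨g, hg.1, hg.2, hgs⟩
  · intro g hg hg0
    exact csInf_le hbdd ⟨g, ⟨hg, hg0⟩, rfl⟩

end Dual

theorem finite_dualOrder {T : L →+ K} (hT : ∀ a b, T (τ a * b) = a * T b) (hT0 : T ≠ 0)
    [IsDomain R] [IsDomain S] [IsFractionRing R K] [IsFractionRing S L] :
    {y ∈ Q | dualOrder (Q ∩ π ⁻¹' {π y}) w (π y) v T y ≠ 0}.Finite := by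
  obtain ⟨B, hBfin, hB⟩ := h.exists_lower_bound hT hT0
  obtain ⟨r, hr, hrd⟩ := h.exists_mem_localDual hT
  have hr' : τ (algebraMap R K r) ≠ 0 := by simpa using hr
  refine (hBfin.union (h.top.finite_support _ hr')).subset fun y hy => ?_
  by_contra hc
  simp only [Set.mem_union, Set.mem_ofPred_eq, hy.1, true_and, not_or, not_not] at hc
  obtain ⟨⟨g, hg, hg0, hgy⟩, hmin⟩ := h.dualOrder_spec hT hT0 hy.1
  have h1 := hB y hy.1 g hg hg0
  have h2 := hmin _ (hrd _ (h.mapsTo y hy.1)) hr'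
  exact hy.2 (by omega)

end FiniteData

end Finite

section DivisorOfMap

variable {R S K L α β : Type*} [CommRing R] [CommRing S] [Field K] [Field L]
  [Algebra R K] [Algebra S L]
  {σ : R →+* S} {τ : K →+* L} {P : Set α} {v : K → α → ℤ} {Q : Set β}
  {w : L → β → ℤ} {π : β → α} {e : β → ℕ}

namespace FiniteData

variable (h : FiniteData σ τ P v Q w π e) [IsDomain R] [IsFractionRing R K] [IsDomain S]
  [IsFractionRing S L] {T : L →+ K} (hT : ∀ a b, T (τ a * b) = a * T b) (hT0 : T ≠ 0)
  {ρ : β → ℤ} (hρ : ∀ y ∈ Q, ρ y = dualOrder (Q ∩ π ⁻¹' {π y}) w (π y) v T y)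
include h hT hT0 hρ

theorem exists_generator {x : α} (hx : x ∈ P) :
    ∃ g ∈ localDual (Q ∩ π ⁻¹' {x}) w x v T, g ≠ 0 ∧ ∀ y ∈ Q ∩ π ⁻¹' {x}, w g y = -ρ y := by
  classical
  have hfin := h.finite_fiber x hx
  set F : Set β := Q ∩ π ⁻¹' {x} with hF
  have key : ∀ y, ∃ c : L, y ∈ F → c ∈ localDual F w x v T ∧ c ≠ 0 ∧ w c y = -ρ y ∧
      ∀ z ∈ F, z ≠ y → 1 - ρ z ≤ w c z := by
    intro y
    by_cases hy : y ∈ F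
    swap
    · exact ⟨0, fun h => absurd h hy⟩
    obtain ⟨hyQ, rfl⟩ : y ∈ Q ∧ π y = x := hy
    obtain ⟨⟨g, hg, hg0, hgy⟩, -⟩ := h.dualOrder_spec hT hT0 hyQ
    obtain ⟨a, ha0, hay, haB⟩ := h.top.exists_approx hyQ 0
      (fun z => if z ∈ F then max 0 (1 - ρ z - w g z) else 0)
      (hfin.subset fun z hz => by by_contra hc; exact hz.2 (if_neg hc))
    have haF : a ∈ secs F w 0 := by
      intro _ z hz
      rw [Pi.zero_apply, add_zero]
      by_cases hzy : z = y
      · rw [hzy, hay]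
      · have := haB z hz.1 hzy
        rw [if_pos hz] at this
        exact (le_max_left _ _).trans this
    refine ⟨a * g, fun _ => ⟨h.mul_mem_localDual T haF hg, mul_ne_zero ha0 hg0, ?_,
      fun z hz hzy => ?_⟩⟩
    · rw [h.top.map_mul ha0 hg0 y hyQ, hay, hgy, zero_add, ← hF, hρ y hyQ]
    · rw [h.top.map_mul ha0 hg0 z hz.1]
      have := haB z hz.1 hzy
      rw [if_pos hz] at this
      have := (le_max_right _ _).trans this
      omega
  choose c hc using key
  have hsum : ∀ y ∈ F, (∑ y ∈ hfin.toFinset, c y) ≠ 0 ∧ w (∑ y ∈ hfin.toFinset, c y) y = -ρ y := by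
    intro y hy
    obtain ⟨-, hc0, hcy, -⟩ := hc y hy
    rw [← Finset.add_sum_erase _ _ (hfin.mem_toFinset.2 hy), ← hcy]
    have hwy := h.top.toIsOrder.mono (Set.singleton_subset_iff.2 hy.1)
    refine h.top.map_add_eq hc0 hy.1 (hwy.sum_mem _ _ fun z hz => ?_)
    rw [Finset.mem_erase, hfin.mem_toFinset] at hz
    rw [mem_secs_singleton]
    intro _
    have := (hc z hz.2).2.2.2 y hy hz.1.symm
    omega
  obtain ⟨y, hy, hyx⟩ := h.exists_over x hx
  refine ⟨∑ y ∈ hfin.toFinset, c y, fun b hb => ?_, (hsum y ⟨hy, hyx⟩).1, fun y hy => (hsum y hy).2⟩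
  rw [Finset.mul_sum, map_sum]
  exact (h.isOrder_singleton hx).sum_mem _ _ fun z hz =>
    (hc z (hfin.mem_toFinset.1 hz)).1 b hb

theorem mem_localDual_iff {x : α} (hx : x ∈ P) (g : L) :
    g ∈ localDual (Q ∩ π ⁻¹' {x}) w x v T ↔ g ∈ secs (Q ∩ π ⁻¹' {x}) w ρ := by
  constructor
  · rintro hg hg0 y ⟨hy, rfl⟩
    have := (h.dualOrder_spec hT hT0 hy).2 g hg hg0
    rw [hρ y hy]
    omega
  · intro hg
    obtain ⟨g₀, hg₀, h0, hord⟩ := h.exists_generator hT hT0 hρ hx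
    rw [← div_mul_cancel₀ g h0]
    refine h.mul_mem_localDual T ?_ hg₀
    rw [div_eq_inv_mul, (h.isOrder_fiber x).mul_mem_iff (inv_ne_zero h0)]
    refine secs_mono le_rfl (fun y hy => ?_) hg
    rw [h.top.map_inv h0 hy.1, hord y hy]
    simp

theorem mem_secs_fiber_iff {x : α} (hx : x ∈ P) (E : α → ℤ) (g : L) :
    (∀ b ∈ secs (Q ∩ π ⁻¹' {x}) w 0, T (b * g) ∈ secs {x} v E) ↔
      g ∈ secs (Q ∩ π ⁻¹' {x}) w fun y => ρ y + e y * E (π y) := by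
  obtain ⟨t, ht, htx⟩ := h.base.exists_order_eq hx (E x)
  have ht' : τ t ≠ 0 := by simpa using ht
  have h1 : (∀ b ∈ secs (Q ∩ π ⁻¹' {x}) w 0, T (b * g) ∈ secs {x} v E) ↔
      τ t * g ∈ localDual (Q ∩ π ⁻¹' {x}) w x v T := by
    refine forall₂_congr fun b _ => ?_
    rw [mul_left_comm, hT, (h.isOrder_singleton hx).mul_mem_iff ht]
    simp only [mem_secs_singleton, htx, Pi.zero_apply, zero_add]
  rw [h1, h.mem_localDual_iff hT hT0 hρ hx, (h.isOrder_fiber x).mul_mem_iff ht']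
  have h2 : ∀ y ∈ Q ∩ π ⁻¹' {x}, ρ y + w (τ t) y = ρ y + e y * E (π y) := by
    rintro y ⟨hy, rfl⟩
    rw [h.order_map y hy t ht, htx]
  constructor
  · exact fun hg => secs_mono le_rfl (fun y hy => (h2 y hy).le) hg
  · exact fun hg => secs_mono le_rfl (fun y hy => (h2 y hy).ge) hg

/-- `g ↦ T (· * g)` identifies the sections of `𝒪(ρ + π^* E)` with the functionals on `S` with
values in `𝒪(E)`. -/
theorem mem_secs_iff (E : α → ℤ) (g : L) :
    (∀ s : S, T (algebraMap S L s * g) ∈ secs P v E) ↔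
      g ∈ secs Q w fun y => ρ y + e y * E (π y) := by
  rw [h.forall_map_mem_iff hT]
  constructor
  · intro hg hg0 y hy
    exact (h.mem_secs_fiber_iff hT hT0 hρ (h.mapsTo y hy) E g).1 (hg _ (h.mapsTo y hy)) hg0 y
      ⟨hy, rfl⟩
  · intro hg x hx
    exact (h.mem_secs_fiber_iff hT hT0 hρ hx E g).2
      (secs_mono Set.inter_subset_left (fun _ _ => le_rfl) hg)

theorem mem_secs_iff_zero (g : L) :
    (∀ s : S, T (algebraMap S L s * g) ∈ secs P v 0) ↔ g ∈ secs Q w ρ := by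
  simpa using h.mem_secs_iff hT hT0 hρ 0 g

end FiniteData

end DivisorOfMap

section Tau

variable {R K α : Type*} [CommRing R] [Field K] [Algebra R K]

/-- The `p^{-e}`-linear maps `φ` with `φ (𝒪(⌈(p^e - 1)Δ⌉)) ⊆ R`. -/
def cartier (R : Type*) {K α : Type*} [CommRing R] [Field K] [Algebra R K] (P : Set α)
    (v : K → α → ℤ) (p : ℕ) (Δ : α → ℚ) (e : ℕ) : Set (K →+ K) :=
  {φ | (∀ a b, φ (a ^ p ^ e * b) = a * φ b) ∧
    ∀ f ∈ secs P v (fun x => ⌈((p : ℚ) ^ e - 1) * Δ x⌉), φ f ∈ (algebraMap R K).range}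

/-- The submodules of `K` that are stable under the maps defining the test ideal. -/
def IsCompatible (P : Set α) (v : K → α → ℤ) (p : ℕ) (Δ : α → ℚ) (I : Ideal R) (t : ℝ)
    (M : Submodule R K) : Prop :=
  ∀ e : ℕ, ∀ φ ∈ cartier R P v p Δ e, ∀ z ∈ I ^ ⌈t * ((p : ℝ) ^ e - 1)⌉₊ • M, φ z ∈ M

/-- The smallest nonzero compatible submodule of `K`. -/
def tau (P : Set α) (v : K → α → ℤ) (p : ℕ) (Δ : α → ℚ) (I : Ideal R) (t : ℝ) : Submodule R K :=
  sInf {M | M ≠ ⊥ ∧ IsCompatible P v p Δ I t M}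

theorem isCompatible_tau (P : Set α) (v : K → α → ℤ) (p : ℕ) (Δ : α → ℚ) (I : Ideal R) (t : ℝ) :
    IsCompatible P v p Δ I t (tau P v p Δ I t) := by
  intro e φ hφ z hz
  rw [tau, Submodule.mem_sInf]
  intro M hM
  exact hM.2 e φ hφ z (Submodule.smul_mono le_rfl (sInf_le hM) hz)

theorem ceil_mul_le (t : ℝ) {p : ℕ} (hp : 1 < p) (e : ℕ) (ht : 0 ≤ t) :
    ⌈t * ((p : ℝ) ^ e - 1)⌉₊ ≤ ⌈t⌉₊ * p ^ e := by
  rw [Nat.ceil_le]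
  push_cast
  have h1 : (1 : ℝ) ≤ (p : ℝ) ^ e := one_le_pow₀ (by exact_mod_cast hp.le)
  have h2 := Nat.le_ceil t
  calc t * ((p : ℝ) ^ e - 1) ≤ t * (p : ℝ) ^ e := by nlinarith
    _ ≤ _ := by gcongr

theorem ceil_add_le (t : ℝ) {p : ℕ} (e e' : ℕ) :
    ⌈t * ((p : ℝ) ^ (e' + e) - 1)⌉₊ ≤
      ⌈t * ((p : ℝ) ^ e' - 1)⌉₊ * p ^ e + ⌈t * ((p : ℝ) ^ e - 1)⌉₊ := by
  rw [Nat.ceil_le]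
  push_cast
  have h1 := Nat.le_ceil (t * ((p : ℝ) ^ e' - 1))
  have h2 := Nat.le_ceil (t * ((p : ℝ) ^ e - 1))
  have h3 : (0 : ℝ) ≤ (p : ℝ) ^ e := by positivity
  calc t * ((p : ℝ) ^ (e' + e) - 1)
      = t * ((p : ℝ) ^ e' - 1) * (p : ℝ) ^ e + t * ((p : ℝ) ^ e - 1) := by ring
    _ ≤ _ := by gcongr

theorem smul_map_eq {q : ℕ} {φ : K →+ K} (hφ : ∀ a b, φ (a ^ q * b) = a * φ b) (r : R) (z : K) :
    r • φ z = φ (r ^ q • z) := by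
  rw [Algebra.smul_def, Algebra.smul_def, map_pow, hφ]

theorem finite_ceil_mul {P : Set α} {Δ : α → ℚ} (hΔ : {x ∈ P | Δ x ≠ 0}.Finite) (c : ℚ) :
    {x ∈ P | ⌈c * Δ x⌉ ≠ 0}.Finite :=
  hΔ.subset fun x hx => ⟨hx.1, fun h0 => hx.2 (by simp [h0])⟩

variable {P : Set α} {v : K → α → ℤ} {p : ℕ} {Δ : α → ℚ} {I : Ideal R} {t : ℝ}

namespace DivisorialData

variable (h : DivisorialData R P v)
include h

/-- The defining condition of a map in `cartier` can be checked, and used, at each prime divisor. -/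
theorem map_mem_singleton {q : ℕ} (hq : 0 < q) {φ : K →+ K} (hφ : ∀ a b, φ (a ^ q * b) = a * φ b)
    {D : α → ℤ} (hD : {x ∈ P | D x ≠ 0}.Finite)
    (hφD : ∀ f ∈ secs P v D, φ f ∈ (algebraMap R K).range) {x : α} (hx : x ∈ P) (E : α → ℤ) {f : K}
    (hf : f ∈ secs {x} v fun y => D y + q * E y) : φ f ∈ secs {x} v E := by
  have hvx := h.toIsOrder.mono (Set.singleton_subset_iff.2 hx)
  obtain ⟨t, ht, htx⟩ := h.exists_order_eq hx (E x)
  have h1 : t ^ q * f ∈ secs {x} v D := by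
    rw [hvx.mul_mem_iff (pow_ne_zero _ ht)]
    refine secs_mono le_rfl ?_ hf
    rintro _ rfl
    rw [h.map_pow ht _ hx, htx]
  obtain ⟨s, hs, hsx, hsf⟩ := h.exists_mul_mem hx D hD h1
  obtain ⟨k, rfl⟩ : ∃ k, q = k + 1 := ⟨q - 1, by omega⟩
  have h2 := hφD _ (h.algebraMap_mul_mem hsf (s ^ k))
  rw [map_pow, ← mul_assoc, ← pow_succ, hφ, hφ, h.mem_range_iff] at h2
  have h3 := mem_secs_iff_forall.1 h2 x hx
  rw [hvx.mul_mem_iff hs, hvx.mul_mem_iff ht] at h3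
  refine secs_mono le_rfl ?_ h3
  rintro _ rfl
  simp [hsx, htx]

theorem map_mem_secs {q : ℕ} (hq : 0 < q) {φ : K →+ K} (hφ : ∀ a b, φ (a ^ q * b) = a * φ b)
    {D : α → ℤ} (hD : {x ∈ P | D x ≠ 0}.Finite)
    (hφD : ∀ f ∈ secs P v D, φ f ∈ (algebraMap R K).range) (E : α → ℤ) {f : K}
    (hf : f ∈ secs P v fun y => D y + q * E y) : φ f ∈ secs P v E := by
  rw [mem_secs_iff_forall] at hf ⊢
  exact fun x hx => h.map_mem_singleton hq hφ hD hφD hx E (hf x hx)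

theorem comp_mem_cartier (hp : 1 < p) (hΔ : {x ∈ P | Δ x ≠ 0}.Finite) {e e' : ℕ} {φ ψ : K →+ K}
    (hφ : φ ∈ cartier R P v p Δ e') (hψ : ψ ∈ cartier R P v p Δ e) :
    φ.comp ψ ∈ cartier R P v p Δ (e' + e) := by
  refine ⟨fun a b => ?_, fun f hf => ?_⟩
  · rw [AddMonoidHom.comp_apply, AddMonoidHom.comp_apply, pow_add, pow_mul, hψ.1, hφ.1]
  · refine hφ.2 _ (h.map_mem_secs (by positivity) hψ.1 (finite_ceil_mul hΔ _) hψ.2 _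
      (secs_mono le_rfl (fun x _ => ?_) hf))
    rw [Int.ceil_le]
    push_cast
    have h1 := Int.le_ceil (((p : ℚ) ^ e - 1) * Δ x)
    have h2 := Int.le_ceil (((p : ℚ) ^ e' - 1) * Δ x)
    calc ((p : ℚ) ^ (e' + e) - 1) * Δ x
        = ((p : ℚ) ^ e - 1) * Δ x + (p : ℚ) ^ e * (((p : ℚ) ^ e' - 1) * Δ x) := by ring
      _ ≤ _ := by gcongr

theorem algebraMap_mulLeft_mem_cartier (r : R) :
    AddMonoidHom.mulLeft (algebraMap R K r) ∈ cartier R P v p Δ 0 := by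
  refine ⟨fun a b => by simp; ring, fun f hf => mul_mem ⟨r, rfl⟩ ?_⟩
  rw [h.mem_range_iff]
  exact secs_mono le_rfl (fun x _ => by simp) hf

theorem tau_le_hull (hp : 1 < p) (hΔ : {x ∈ P | Δ x ≠ 0}.Finite) {c : K} (hc : c ≠ 0) :
    tau P v p Δ I t ≤ Submodule.span R {y | ∃ e, ∃ φ ∈ cartier R P v p Δ e,
      ∃ z ∈ I ^ ⌈t * ((p : ℝ) ^ e - 1)⌉₊ • Submodule.span R {c}, φ z = y} := by
  refine sInf_le ⟨?_, fun e' φ' hφ' z hz => ?_⟩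
  · intro hbot
    have : c ∈ (⊥ : Submodule R K) := by
      rw [← hbot]
      refine Submodule.subset_span ⟨0, _, h.algebraMap_mulLeft_mem_cartier 1, c, ?_, by simp⟩
      simp
    exact hc (by simpa using this)
  · set H := Submodule.span R {y | ∃ e, ∃ φ ∈ cartier R P v p Δ e,
      ∃ z ∈ I ^ ⌈t * ((p : ℝ) ^ e - 1)⌉₊ • Submodule.span R {c}, φ z = y}
    have key : ∀ m ∈ H, ∀ r ∈ I ^ ⌈t * ((p : ℝ) ^ e' - 1)⌉₊, φ' (r • m) ∈ H := by
      intro m hm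
      induction hm using Submodule.span_induction with
      | mem m hm =>
        obtain ⟨e, φ, hφ, z, hz, rfl⟩ := hm
        intro r hr
        refine Submodule.subset_span ⟨e' + e, _, h.comp_mem_cartier hp hΔ hφ' hφ,
          r ^ p ^ e • z, ?_, ?_⟩
        · have h1 : r ^ p ^ e ∈ I ^ (⌈t * ((p : ℝ) ^ e' - 1)⌉₊ * p ^ e) := by
            rw [pow_mul]; exact Ideal.pow_mem_pow hr _
          have h2 := Submodule.smul_mem_smul h1 hz
          rw [← mul_smul, ← pow_add] at h2
          exact Submodule.smul_mono_left (Ideal.pow_le_pow_right (ceil_add_le t e e')) h2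
        · rw [AddMonoidHom.comp_apply, smul_map_eq hφ.1]
      | zero => intro r _; simp
      | add m m' _ _ hm hm' =>
        intro r hr
        rw [smul_add, map_add]
        exact add_mem (hm r hr) (hm' r hr)
      | smul a m _ hm =>
        intro r hr
        rw [← mul_smul]
        exact hm _ (Ideal.mul_mem_right _ _ hr)
    induction hz using Submodule.smul_induction_on' with
    | smul r hr m hm => exact key m hm r hr
    | add x _ y _ hx hy => rw [map_add]; exact add_mem hx hy

/-- Test ideals are nonzero. -/
theorem tau_ne_bot [IsDomain R] [IsNoetherianRing R] [IsFractionRing R K] [Fact p.Prime] [CharP R p]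
    (hF : (frobenius R p).Finite) (hΔ : {x ∈ P | Δ x ≠ 0}.Finite) (hI : I ≠ ⊥) (ht : 0 ≤ t) :
    tau P v p Δ I t ≠ ⊥ := by
  have hp : 1 < p := (Fact.out : p.Prime).one_lt
  have hinj := IsFractionRing.injective R K
  obtain ⟨c, hc0, hc⟩ := exists_testElement (K := K) hF
  obtain ⟨r, hr0, hr⟩ := h.exists_bound (fun x => ⌈1 * Δ x⌉) (finite_ceil_mul hΔ 1)
  obtain ⟨i, hi, hi0⟩ := Submodule.exists_mem_ne_zero_of_ne_bot hI
  set b : R := r * i ^ ⌈t⌉₊ with hb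
  have hib : algebraMap R K (i ^ ⌈t⌉₊) ≠ 0 := by simpa using fun h0 => absurd h0 hi0
  have hb0 : algebraMap R K b ≠ 0 := by rw [hb, map_mul]; exact mul_ne_zero hr0 hib
  have hbI : b ∈ I ^ ⌈t⌉₊ := Ideal.mul_mem_left _ _ (Ideal.pow_mem_pow hi _)
  have hbv : ∀ x ∈ P, Δ x ≤ v (algebraMap R K b) x ∧ 0 ≤ v (algebraMap R K b) x := by
    intro x hx
    refine ⟨?_, h.order_nonneg hb0 hx⟩
    have h1 := h.order_nonneg hib hx
    have h2 := hr x hx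
    have h3 := Int.le_ceil (1 * Δ x)
    rw [one_mul] at h2 h3
    rw [hb, map_mul, h.map_mul hr0 hib x hx, Int.cast_add]
    have : ((⌈Δ x⌉ : ℤ) : ℚ) ≤ v (algebraMap R K r) x := by exact_mod_cast h2
    have : (0 : ℚ) ≤ v (algebraMap R K (i ^ ⌈t⌉₊)) x := by exact_mod_cast h1
    linarith
  have hmem : algebraMap R K (b ^ 2 * c) ∈ tau P v p Δ I t := by
    rw [tau, Submodule.mem_sInf]
    rintro M ⟨hM0, hM⟩
    obtain ⟨m, hm, hm0⟩ := Submodule.exists_mem_ne_zero_of_ne_bot hM0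
    obtain ⟨a, d, hd, rfl⟩ := IsFractionRing.div_surjective (A := R) m
    have hd0 : algebraMap R K d ≠ 0 := by simpa using nonZeroDivisors.ne_zero hd
    have haM : algebraMap R K a ∈ M := by
      have := M.smul_mem d hm
      rwa [Algebra.smul_def, mul_div_cancel₀ _ hd0] at this
    have ha0 : a ≠ 0 := by
      rintro rfl
      simp at hm0
    obtain ⟨e, φ, hφ, hφa⟩ := hc a ha0
    have hq : 1 ≤ p ^ e := Nat.one_le_pow _ _ (by omega)
    have hφ' : φ.comp (AddMonoidHom.mulLeft (algebraMap R K b ^ p ^ e)) ∈ cartier R P v p Δ e := by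
      refine ⟨fun x y => ?_, fun f hf => ?_⟩
      · simp only [AddMonoidHom.comp_apply, AddMonoidHom.coe_mulLeft]
        rw [mul_left_comm, hφ.1]
      · simp only [AddMonoidHom.comp_apply, AddMonoidHom.coe_mulLeft]
        have hbf : algebraMap R K b ^ p ^ e * f ∈ (algebraMap R K).range := by
          rw [h.mem_range_iff, h.mul_mem_iff (pow_ne_zero _ hb0)]
          refine secs_mono le_rfl (fun x hx => ?_) hf
          rw [h.map_pow hb0 _ hx, Int.ceil_le]
          obtain ⟨h1, h2⟩ := hbv x hx
          have h3 : (1 : ℚ) ≤ (p : ℚ) ^ e := by exact_mod_cast hq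
          have h4 : (0 : ℚ) ≤ v (algebraMap R K b) x := by exact_mod_cast h2
          simp only [Pi.zero_apply, zero_add]
          push_cast
          nlinarith
        obtain ⟨g, hg⟩ := hbf
        rw [← hg]
        exact hφ.2 g
    have h1 : b ^ p ^ e • algebraMap R K a ∈ I ^ ⌈t * ((p : ℝ) ^ e - 1)⌉₊ • M := by
      refine Submodule.smul_mem_smul ?_ haM
      refine Ideal.pow_le_pow_right (ceil_mul_le t hp e ht) ?_
      rw [pow_mul]
      exact Ideal.pow_mem_pow hbI _
    have h2 := hM e _ hφ' _ h1
    convert h2 using 1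
    simp only [AddMonoidHom.comp_apply, AddMonoidHom.coe_mulLeft, Algebra.smul_def]
    rw [hφ.1, map_pow, hφ.1, hφa, map_mul, map_pow]
    ring
  intro hbot
  rw [hbot, Submodule.mem_bot, map_mul, map_pow] at hmem
  have hcK : algebraMap R K c ≠ 0 := by simpa using hc0
  exact mul_ne_zero (pow_ne_zero _ hb0) hcK hmem

theorem comp_mulLeft_mem_cartier (hp : 0 < p) {Δ' : α → ℚ} {f : K} (hf : f ≠ 0)
    (hΔ' : ∀ x ∈ P, Δ' x = Δ x + v f x) {e : ℕ} {φ : K →+ K} (hφ : φ ∈ cartier R P v p Δ e) :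
    φ.comp (AddMonoidHom.mulLeft (f ^ (p ^ e - 1))) ∈ cartier R P v p Δ' e := by
  refine ⟨fun x y => ?_, fun g hg => hφ.2 _ ?_⟩
  · simp only [AddMonoidHom.comp_apply, AddMonoidHom.coe_mulLeft]
    rw [mul_left_comm, hφ.1]
  · rw [AddMonoidHom.coe_mulLeft, h.mul_mem_iff (pow_ne_zero _ hf)]
    refine secs_mono le_rfl (fun x hx => ?_) hg
    have hq : 1 ≤ p ^ e := Nat.one_le_pow _ _ hp
    rw [h.map_pow hf _ hx, hΔ' x hx, mul_add, ← Int.ceil_add_intCast]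
    push_cast [Nat.cast_sub hq]
    rfl

/-- The test ideal of a divisor that need not be effective, computed after adding a principal
divisor, is the smallest nonzero compatible submodule. -/
theorem comap_sInf_eq_tau [IsDomain R] [IsFractionRing R K] (hp : 0 < p) (f : R) (hf : f ≠ 0)
    {Δ' : α → ℚ} (hΔ' : ∀ x ∈ P, Δ' x = Δ x + v (algebraMap R K f) x)
    (hpos : ∀ x ∈ P, 0 ≤ Δ' x) :
    Submodule.comap (f • LinearMap.id) (Submodule.map (Algebra.linearMap R K)
      (sInf {J : Ideal R | J ≠ ⊥ ∧ ∀ e : ℕ, ∀ φ ∈ cartier R P v p Δ' e,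
        ∀ z ∈ I ^ ⌈t * ((p : ℝ) ^ e - 1)⌉₊ * J, ∃ w ∈ J,
          φ (algebraMap R K z) = algebraMap R K w})) = tau P v p Δ I t := by
  have hinj := IsFractionRing.injective R K
  have hfK : algebraMap R K f ≠ 0 := by simpa using hf
  have hintegral : ∀ e : ℕ, ∀ φ ∈ cartier R P v p Δ' e, ∀ z : R,
      φ (algebraMap R K z) ∈ (algebraMap R K).range := by
    refine fun e φ hφ z => hφ.2 _ (secs_mono le_rfl (fun x hx => ?_) (h.algebraMap_mem z))
    have hq : (1 : ℚ) ≤ (p : ℚ) ^ e := one_le_pow₀ (by exact_mod_cast hp)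
    have := hpos x hx
    rw [Pi.zero_apply]
    exact Int.ceil_nonneg (mul_nonneg (by linarith) this)
  have hpow : ∀ (e : ℕ) (x : K), algebraMap R K f ^ (p ^ e - 1) * (algebraMap R K f * x) =
      algebraMap R K f ^ p ^ e * x := by
    intro e x
    rw [← mul_assoc, ← pow_succ, Nat.sub_add_cancel (Nat.one_le_pow _ _ hp)]
  apply le_antisymm
  · rintro k ⟨r, hr, hrk⟩
    rw [tau, Submodule.mem_sInf]
    rintro M ⟨hM0, hM⟩
    have hmem : ∀ r : R, r ∈ Submodule.comap (Algebra.linearMap R K)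
        (M.map (f • LinearMap.id)) ↔ ∃ m ∈ M, algebraMap R K f * m = algebraMap R K r := by
      intro r
      simp [Submodule.mem_map, Algebra.smul_def]
    have hJ : r ∈ Submodule.comap (Algebra.linearMap R K) (M.map (f • LinearMap.id)) := by
      refine Submodule.mem_sInf.1 hr _ ⟨?_, fun e φ hφ z hz => ?_⟩
      · obtain ⟨m, hm, hm0⟩ := Submodule.exists_mem_ne_zero_of_ne_bot hM0
        obtain ⟨a, d, hd, rfl⟩ := IsFractionRing.div_surjective (A := R) m
        have hd0 : algebraMap R K d ≠ 0 := by simpa using nonZeroDivisors.ne_zero hd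
        have haM : algebraMap R K a ∈ M := by
          have := M.smul_mem d hm
          rwa [Algebra.smul_def, mul_div_cancel₀ _ hd0] at this
        have ha0 : a ≠ 0 := by
          rintro rfl
          simp at hm0
        refine (Submodule.ne_bot_iff _).2 ⟨f * a, (hmem _).2 ⟨_, haM, by rw [map_mul]⟩,
          mul_ne_zero hf ha0⟩
      · obtain ⟨y, hy, hyz⟩ : ∃ y ∈ I ^ ⌈t * ((p : ℝ) ^ e - 1)⌉₊ • M,
            algebraMap R K z = algebraMap R K f * y := by
          induction hz using Submodule.mul_induction_on' with
          | mem_mul_mem a ha j hj =>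
            obtain ⟨m, hm, hmj⟩ := (hmem j).1 hj
            refine ⟨a • m, Submodule.smul_mem_smul ha hm, ?_⟩
            rw [map_mul, ← hmj, Algebra.smul_def]
            ring
          | add x _ y _ hx hy =>
            obtain ⟨a, ha, hax⟩ := hx
            obtain ⟨b, hb, hby⟩ := hy
            exact ⟨a + b, add_mem ha hb, by rw [map_add, hax, hby, mul_add]⟩
        obtain ⟨w, hw⟩ := hintegral e φ hφ z
        refine ⟨w, (hmem w).2 ?_, hw.symm⟩
        have hφ' := h.comp_mulLeft_mem_cartier hp (inv_ne_zero hfK) (Δ' := Δ) (fun x hx => by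
          rw [hΔ' x hx, h.map_inv hfK hx]; push_cast; ring) hφ
        refine ⟨_, hM e _ hφ' y hy, ?_⟩
        rw [hw, hyz, AddMonoidHom.comp_apply, AddMonoidHom.coe_mulLeft, ← hφ.1, ← hpow, inv_pow]
        congr 1
        have : algebraMap R K f ^ (p ^ e - 1) ≠ 0 := pow_ne_zero _ hfK
        field_simp
    obtain ⟨m, hm, hmr⟩ := (hmem r).1 hJ
    have hrk' : algebraMap R K r = algebraMap R K f * k := by
      simpa [Algebra.smul_def] using hrk
    rw [hrk'] at hmr
    rwa [← mul_left_cancel₀ hfK hmr]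
  · intro k hk
    have key : ∀ J : Ideal R, (J ≠ ⊥ ∧ ∀ e : ℕ, ∀ φ ∈ cartier R P v p Δ' e,
        ∀ z ∈ I ^ ⌈t * ((p : ℝ) ^ e - 1)⌉₊ * J, ∃ w ∈ J,
          φ (algebraMap R K z) = algebraMap R K w) →
        ∃ r ∈ J, algebraMap R K r = algebraMap R K f * k := by
      rintro J ⟨hJ0, hJ⟩
      have hmem : ∀ k : K, k ∈ Submodule.comap (f • LinearMap.id)
          (Submodule.map (Algebra.linearMap R K) J) ↔
            ∃ r ∈ J, algebraMap R K r = algebraMap R K f * k := by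
        intro k
        simp [Algebra.smul_def]
      refine (hmem k).1 (Submodule.mem_sInf.1 hk _ ⟨?_, fun e φ hφ z hz => ?_⟩)
      · obtain ⟨j, hj, hj0⟩ := Submodule.exists_mem_ne_zero_of_ne_bot hJ0
        refine (Submodule.ne_bot_iff _).2 ⟨algebraMap R K j / algebraMap R K f,
          (hmem _).2 ⟨j, hj, by rw [mul_div_cancel₀ _ hfK]⟩, ?_⟩
        exact div_ne_zero (by simpa using hj0) hfK
      · obtain ⟨y, hy, hyz⟩ : ∃ y ∈ I ^ ⌈t * ((p : ℝ) ^ e - 1)⌉₊ * J,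
            algebraMap R K y = algebraMap R K f * z := by
          induction hz using Submodule.smul_induction_on' with
          | smul a ha m hm =>
            obtain ⟨r, hr, hrm⟩ := (hmem m).1 hm
            refine ⟨a * r, Ideal.mul_mem_mul ha hr, ?_⟩
            rw [map_mul, hrm, Algebra.smul_def]
            ring
          | add x _ y _ hx hy =>
            obtain ⟨a, ha, hax⟩ := hx
            obtain ⟨b, hb, hby⟩ := hy
            exact ⟨a + b, add_mem ha hb, by rw [map_add, hax, hby, mul_add]⟩
        have hφ' := h.comp_mulLeft_mem_cartier hp hfK hΔ' hφ
        obtain ⟨w, hw, hwy⟩ := hJ e _ hφ' y hy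
        refine (hmem _).2 ⟨w, hw, ?_⟩
        rw [← hwy, hyz, AddMonoidHom.comp_apply, AddMonoidHom.coe_mulLeft, hpow, hφ.1]
    obtain ⟨r, -, hr⟩ := key ⊤ ⟨top_ne_bot, fun e φ hφ z _ => by
      obtain ⟨w, hw⟩ := hintegral e φ hφ z
      exact ⟨w, Submodule.mem_top, hw.symm⟩⟩
    refine ⟨r, Submodule.mem_sInf.2 fun J hJ => ?_, by simpa [Algebra.smul_def] using hr⟩
    obtain ⟨r', hr', hrr⟩ := key J hJ
    rwa [hinj (hr.trans hrr.symm)]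

end DivisorialData

end Tau

section Transformation

variable {R S K L α β : Type*} [CommRing R] [CommRing S] [Field K] [Field L]
  [Algebra R K] [Algebra S L]
  {σ : R →+* S} {τ : K →+* L} {P : Set α} {v : K → α → ℤ} {Q : Set β}
  {w : L → β → ℤ} {π : β → α} {e : β → ℕ}

/-- A `p^{-n}`-linear endomorphism of `K` lifts to `L` along a nonzero functional. -/
theorem exists_lift {p : ℕ} [Fact p.Prime] [CharP L p] (n : ℕ) (hτ : τ.Finite) {T : L →+ K}
    (hT : ∀ a b, T (τ a * b) = a * T b) (hT0 : T ≠ 0) {φ : K →+ K}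
    (hφ : ∀ a b, φ (a ^ p ^ n * b) = a * φ b) :
    ∃ ψ : L →+ L, (∀ a b, ψ (a ^ p ^ n * b) = a * ψ b) ∧
      ∀ a b, T (a * ψ b) = φ (T (a ^ p ^ n * b)) := by
  have hex : ∀ b : L, ∃ u : L, ∀ a, φ (T (a ^ p ^ n * b)) = T (a * u) := by
    intro b
    let Θ : L →+ K := (φ.comp T).comp ((AddMonoidHom.mulRight b).comp
      (iterateFrobenius L p n).toAddMonoidHom)
    refine exists_eq_functional_mul τ hτ T Θ hT (fun a x => ?_) hT0
    change φ (T ((τ a * x) ^ p ^ n * b)) = a * φ (T (x ^ p ^ n * b))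
    rw [mul_pow, mul_assoc, ← map_pow, hT, hφ]
  choose ψ hψ using hex
  refine ⟨⟨⟨ψ, ?_⟩, fun b c => ?_⟩, fun c b => ?_, fun a b => (hψ b a).symm⟩
  · refine functional_mul_injective hT0 fun a => ?_
    rw [← hψ]
    simp
  · refine functional_mul_injective hT0 fun a => ?_
    rw [mul_add, map_add, ← hψ, ← hψ, ← hψ, mul_add, map_add, map_add]
  · refine functional_mul_injective hT0 fun a => ?_
    change T (a * ψ (c ^ p ^ n * b)) = T (a * (c * ψ b))
    rw [← hψ, ← mul_assoc, ← mul_assoc, ← hψ, mul_pow]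

namespace FiniteData

variable (h : FiniteData σ τ P v Q w π e) [IsDomain R] [IsFractionRing R K] [IsDomain S]
  [IsFractionRing S L] {T : L →+ K} (hT : ∀ a b, T (τ a * b) = a * T b) (hT0 : T ≠ 0)
  {ρ : β → ℤ} (hρ : ∀ y ∈ Q, ρ y = dualOrder (Q ∩ π ⁻¹' {π y}) w (π y) v T y)
  {p : ℕ} [Fact p.Prime] {Δ : α → ℚ} (hΔ : {x ∈ P | Δ x ≠ 0}.Finite) {ΔY : β → ℚ}
  (hΔY : ∀ y ∈ Q, ΔY y = Δ (π y) * e y - ρ y)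

include h hT hT0 hρ hΔ hΔY

theorem finite_support_pullback_sub : {y ∈ Q | ΔY y ≠ 0}.Finite := by
  refine ((h.finite_dualOrder hT hT0).union (h.finite_pullback hΔ)).subset fun y hy => ?_
  by_contra hc
  simp only [Set.mem_union, Set.mem_ofPred_eq, hy.1, true_and, not_or, not_not] at hc
  exact hy.2 (by rw [hΔY y hy.1, hρ y hy.1, hc.1, hc.2]; simp)

theorem exists_lift_mem_cartier [CharP L p] (n : ℕ) {φ : K →+ K}
    (hφ : φ ∈ cartier R P v p Δ n) :
    ∃ ψ ∈ cartier S Q w p ΔY n, ∀ b, T (ψ b) = φ (T b) := by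
  have hp : 1 < p := (Fact.out : p.Prime).one_lt
  have hτ := finite_fractionField σ τ h.comm h.finite
  obtain ⟨ψ, hψ, hψT⟩ := exists_lift n hτ hT hT0 hφ.1
  refine ⟨ψ, ⟨hψ, fun f hf => ?_⟩, fun b => by simpa using hψT 1 b⟩
  rw [h.top.mem_range_iff]
  intro hψf0 y hy
  have hx := h.mapsTo y hy
  obtain ⟨g, hg, hg0, hgρ⟩ := h.exists_generator hT hT0 hρ hx
  set F := Q ∩ π ⁻¹' {π y} with hF
  have hdual : g * ψ f ∈ localDual F w (π y) v T := by
    intro b hb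
    rw [← mul_assoc, hψT]
    refine h.base.map_mem_singleton (by positivity) hφ.1 (finite_ceil_mul hΔ _) hφ.2 hx 0 ?_
    simp only [Pi.zero_apply, mul_zero, add_zero]
    have := (h.mem_secs_fiber_iff hT hT0 hρ hx (fun x => ⌈((p : ℚ) ^ n - 1) * Δ x⌉)
      ((b * g) ^ p ^ n * f)).2 ?_ 1 ?_
    · simpa using this
    · intro h0 z hz
      have hbg0 : (b * g) ^ p ^ n ≠ 0 := left_ne_zero_of_mul h0
      have hf0 : f ≠ 0 := right_ne_zero_of_mul h0
      have hbg : b * g ≠ 0 := fun h1 => hbg0 (by rw [h1, zero_pow (by positivity)])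
      have hb0 : b ≠ 0 := left_ne_zero_of_mul hbg
      have h1 := hb hb0 z hz
      have h2 := hf hf0 z hz.1
      rw [Pi.zero_apply, add_zero] at h1
      rw [h.top.map_mul hbg0 hf0 z hz.1, h.top.map_pow hbg _ hz.1, h.top.map_mul hb0 hg0 z hz.1,
        hgρ z hz]
      dsimp only at h2 ⊢
      have h3 : ⌈((p : ℚ) ^ n - 1) * ΔY z⌉ ≤
          e z * ⌈((p : ℚ) ^ n - 1) * Δ (π z)⌉ - ((p : ℤ) ^ n - 1) * ρ z := by
        rw [Int.ceil_le, hΔY z hz.1]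
        push_cast
        have h4 := Int.le_ceil (((p : ℚ) ^ n - 1) * Δ (π z))
        have h5 : (0 : ℚ) ≤ e z := by positivity
        nlinarith
      have h4 : (0 : ℤ) ≤ (p : ℤ) ^ n * w b z := by positivity
      push_cast
      linarith
    · intro _ z hz
      simp [h.top.map_one hz.1]
  have h1 := (h.mem_localDual_iff hT hT0 hρ hx _).1 hdual
  rw [(h.isOrder_fiber _).mul_mem_iff hg0] at h1
  have h2 := h1 hψf0 y ⟨hy, rfl⟩
  dsimp only at h2
  rw [hgρ y ⟨hy, rfl⟩, add_neg_cancel] at h2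
  exact h2

theorem exists_image_multiplier : ∃ b : S, algebraMap S L b ≠ 0 ∧
    ∀ n : ℕ, ∀ ψ ∈ cartier S Q w p ΔY n, ∀ s : S,
      ∀ f ∈ secs P v (fun x => ⌈((p : ℚ) ^ n - 1) * Δ x⌉),
        T (ψ (algebraMap S L s * algebraMap S L b * τ f)) ∈ (algebraMap R K).range := by
  classical
  have hp : 1 < p := (Fact.out : p.Prime).one_lt
  have hρfin : {y ∈ Q | ρ y ≠ 0}.Finite := (h.finite_dualOrder hT hT0).subset fun y hy =>
    ⟨hy.1, by rw [← hρ y hy.1]; exact hy.2⟩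
  have hΔfin := h.finite_pullback hΔ
  have hΔYfin := h.finite_support_pullback_sub hT hT0 hρ hΔ hΔY
  obtain ⟨b, hb0, hb⟩ := h.top.exists_bound
    (fun y => if Δ (π y) = 0 ∧ ρ y = 0 then 0 else (e y : ℤ) + |ρ y|)
    ((hρfin.union hΔfin).subset fun y hy => by
      by_contra hc
      simp only [Set.mem_union, Set.mem_ofPred_eq, hy.1, true_and, not_or, not_not] at hc
      exact hy.2 (if_pos ⟨hc.2, hc.1⟩))
  refine ⟨b, hb0, fun n ψ hψ s f hf => ?_⟩
  have hmem : ψ (algebraMap S L s * algebraMap S L b * τ f) ∈ secs Q w ρ := by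
    refine h.top.map_mem_secs (by positivity) hψ.1 (finite_ceil_mul hΔYfin _) hψ.2 ρ ?_
    rw [mul_assoc]
    refine h.top.algebraMap_mul_mem ?_ s
    intro h0 y hy
    have hf0 : f ≠ 0 := by rintro rfl; simp at h0
    have h1 := hf hf0 _ (h.mapsTo y hy)
    have h2 := hb y hy
    rw [h.top.map_mul hb0 (right_ne_zero_of_mul h0) y hy, h.order_map y hy f hf0]
    dsimp only at h1 h2 ⊢
    have h3 : (0 : ℤ) ≤ e y * (v f (π y) + ⌈((p : ℚ) ^ n - 1) * Δ (π y)⌉) := by positivity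
    have h5 := h.top.order_nonneg hb0 hy
    split_ifs at h2 with hz
    · have : ΔY y = 0 := by rw [hΔY y hy, hz.1, hz.2]; simp
      rw [hz.1] at h3
      rw [this, hz.2]
      simp only [mul_zero, Int.ceil_zero, add_zero] at h3 ⊢
      omega
    · have h4 : (e y : ℤ) * ⌈((p : ℚ) ^ n - 1) * Δ (π y)⌉ ≤
          ⌈((p : ℚ) ^ n - 1) * ΔY y⌉ + ((p : ℤ) ^ n - 1) * ρ y + e y := by
        have h6 := Int.ceil_lt_add_one (((p : ℚ) ^ n - 1) * Δ (π y))
        have h7 := Int.le_ceil (((p : ℚ) ^ n - 1) * ΔY y)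
        rw [hΔY y hy] at h7 ⊢
        have h8 : (0 : ℚ) ≤ e y := by positivity
        have h9 : (e y : ℚ) * ⌈((p : ℚ) ^ n - 1) * Δ (π y)⌉ ≤
          ⌈((p : ℚ) ^ n - 1) * (Δ (π y) * e y - ρ y)⌉ + ((p : ℚ) ^ n - 1) * ρ y + e y := by
          nlinarith
        exact_mod_cast h9
      have h10 := neg_abs_le (ρ y)
      push_cast
      linarith
  have := (h.mem_secs_iff_zero hT hT0 hρ _).2 hmem 1
  rw [h.base.mem_range_iff]
  simpa using this

variable {I : Ideal R} {t : ℝ}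

theorem map_tau_le [CharP K p] [CharP L p] (hK : (frobenius K p).Finite)
    (hL : (frobenius L p).Finite) {g : L} (hg : g ∈ tau Q w p ΔY (I.map σ) t) :
    T g ∈ tau P v p Δ I t := by
  have hp : 1 < p := (Fact.out : p.Prime).one_lt
  rw [tau, Submodule.mem_sInf]
  rintro M ⟨hM0, hM⟩
  obtain ⟨m, hm, hm0⟩ := Submodule.exists_mem_ne_zero_of_ne_bot hM0
  obtain ⟨b, hb0, hb⟩ := h.exists_image_multiplier hT hT0 hρ (p := p) hΔ hΔY
  have hτ := finite_fractionField σ τ h.comm h.finite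
  set c : L := algebraMap S L b * τ m with hc
  have hc0 : c ≠ 0 := mul_ne_zero hb0 (by simpa using hm0)
  have hgen : ∀ n : ℕ, ∀ ψ ∈ cartier S Q w p ΔY n,
      ∀ j ∈ (I ^ ⌈t * ((p : ℝ) ^ n - 1)⌉₊).map σ, ∀ s : S, T (ψ ((s * j) • c)) ∈ M := by
    intro n ψ hψ j hj
    obtain ⟨φ, hφ, hφ1⟩ := exists_functional_ne_zero _ (iterateFrobenius_finite hK n)
    simp only [iterateFrobenius_def] at hφ
    obtain ⟨u, hu⟩ : ∃ u, ∀ x, (T.comp ψ) x = (φ.comp T) (x * u) := by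
      refine exists_eq_functional_mul ((iterateFrobenius L p n).comp τ)
        ((iterateFrobenius_finite hL n).comp hτ) _ _ (fun a x => ?_) (fun a x => ?_) fun h0 => ?_
      · simp only [RingHom.comp_apply, AddMonoidHom.comp_apply, iterateFrobenius_def]
        rw [← map_pow, hT, hφ]
      · simp only [RingHom.comp_apply, AddMonoidHom.comp_apply, iterateFrobenius_def]
        rw [hψ.1, hT]
      · obtain ⟨x, hx⟩ : ∃ x, T x ≠ 0 := by
          by_contra! h1
          exact hT0 (AddMonoidHom.ext h1)
        have h1 : (φ.comp T) (τ (T x)⁻¹ * x) = 0 := by rw [h0]; rfl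
        rw [AddMonoidHom.comp_apply, hT, inv_mul_cancel₀ hx, hφ1] at h1
        exact one_ne_zero h1
    simp only [AddMonoidHom.comp_apply] at hu
    have hbase : ∀ i ∈ I ^ ⌈t * ((p : ℝ) ^ n - 1)⌉₊, ∀ s : S, T (ψ ((s * σ i) • c)) ∈ M := by
      intro i hi s
      have hcart : φ.comp (AddMonoidHom.mulLeft (T (algebraMap S L s * algebraMap S L b * u))) ∈
          cartier R P v p Δ n := by
        refine ⟨fun x y => ?_, fun f hf => ?_⟩
        · simp only [AddMonoidHom.comp_apply, AddMonoidHom.coe_mulLeft]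
          rw [mul_left_comm, hφ]
        · have := hb n ψ hψ s f hf
          rw [hu, mul_right_comm, mul_comm _ (τ f), hT, mul_comm] at this
          exact this
      have := hM n _ hcart (i • m) (Submodule.smul_mem_smul hi hm)
      convert this using 1
      rw [hu, Algebra.smul_def, Algebra.smul_def, AddMonoidHom.comp_apply, AddMonoidHom.coe_mulLeft,
        mul_comm (T _), ← hT, map_mul τ, map_mul (algebraMap S L), h.comm, hc]
      congr 2
      ring
    induction hj using Submodule.span_induction with
    | mem j hj =>
      obtain ⟨i, hi, rfl⟩ := hj
      exact hbase i hi
    | zero => intro s; simp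
    | add j j' _ _ hj hj' =>
      intro s
      rw [mul_add, add_smul, map_add, map_add]
      exact add_mem (hj s) (hj' s)
    | smul a j _ hj =>
      intro s
      rw [smul_eq_mul, ← mul_assoc]
      exact hj _
  have hspan : ∀ n : ℕ, ∀ ψ ∈ cartier S Q w p ΔY n,
      ∀ z ∈ (I.map σ) ^ ⌈t * ((p : ℝ) ^ n - 1)⌉₊ • Submodule.span S {c}, T (ψ z) ∈ M := by
    intro n ψ hψ z hz
    rw [← Ideal.map_pow] at hz
    induction hz using Submodule.smul_induction_on' with
    | smul j hj x hx =>
      obtain ⟨s, rfl⟩ := Submodule.mem_span_singleton.1 hx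
      rw [← mul_smul, mul_comm]
      exact hgen n ψ hψ j hj s
    | add x _ y _ hx hy => rw [map_add, map_add]; exact add_mem hx hy
  have hall := h.top.tau_le_hull hp (h.finite_support_pullback_sub hT hT0 hρ hΔ hΔY) hc0 hg
  clear hg
  suffices ∀ s : S, T (s • g) ∈ M by simpa using this 1
  induction hall using Submodule.span_induction with
  | mem y hy =>
    obtain ⟨n, ψ, hψ, z, hz, rfl⟩ := hy
    intro s
    rw [smul_map_eq hψ.1]
    exact hspan n ψ hψ _ (Submodule.smul_mem _ _ hz)
  | zero => intro s; simp
  | add y y' _ _ hy hy' =>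
    intro s
    rw [smul_add, map_add]
    exact add_mem (hy s) (hy' s)
  | smul a y _ hy =>
    intro s
    rw [← mul_smul]
    exact hy _

theorem tau_le_map [CharP L p] (hne : tau Q w p ΔY (I.map σ) t ≠ ⊥) {k : K}
    (hk : k ∈ tau P v p Δ I t) : ∃ g ∈ tau Q w p ΔY (I.map σ) t, T g = k := by
  have hsmul : ∀ (r : R) (g : L), T (σ r • g) = r • T g := fun r g => by
    rw [Algebra.smul_def, Algebra.smul_def, ← h.comm, hT]
  let M : Submodule R K :=
    { carrier := T '' (tau Q w p ΔY (I.map σ) t : Set L)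
      zero_mem' := ⟨0, zero_mem _, map_zero T⟩
      add_mem' := by
        rintro _ _ ⟨g, hg, rfl⟩ ⟨g', hg', rfl⟩
        exact ⟨g + g', add_mem hg hg', map_add T g g'⟩
      smul_mem' := by
        rintro r _ ⟨g, hg, rfl⟩
        exact ⟨σ r • g, Submodule.smul_mem _ _ hg, hsmul r g⟩ }
  suffices M ≠ ⊥ ∧ IsCompatible P v p Δ I t M from Submodule.mem_sInf.1 hk M this
  constructor
  · obtain ⟨g, hg, hg0⟩ := Submodule.exists_mem_ne_zero_of_ne_bot hne
    obtain ⟨x, hx⟩ : ∃ x, T x ≠ 0 := by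
      by_contra! h1
      exact hT0 (AddMonoidHom.ext h1)
    obtain ⟨a, d, hd, had⟩ := IsFractionRing.div_surjective (A := S) (x / g)
    have hd0 := nonZeroDivisors.ne_zero hd
    obtain ⟨r, hr, s, hs⟩ := exists_ne_zero_dvd_of_finite σ h.finite hd0
    have hdL : algebraMap S L d ≠ 0 := by simpa using hd0
    have hrx : σ r • x = (s * a) • g := by
      rw [Algebra.smul_def, Algebra.smul_def, hs, map_mul, map_mul]
      rw [div_eq_div_iff hdL hg0] at had
      linear_combination -algebraMap S L s * had
    refine (Submodule.ne_bot_iff _).2 ⟨T (σ r • x), ⟨_, Submodule.smul_mem _ (s * a) hg, ?_⟩, ?_⟩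
    · rw [hrx]
    · rw [hsmul, Algebra.smul_def]
      exact mul_ne_zero (by simpa using hr) hx
  · intro n φ hφ z hz
    obtain ⟨ψ, hψ, hψT⟩ := h.exists_lift_mem_cartier hT hT0 hρ hΔ hΔY n hφ
    induction hz using Submodule.smul_induction_on' with
    | smul r hr m hm =>
      obtain ⟨g, hg, rfl⟩ := hm
      refine ⟨ψ (σ r • g), isCompatible_tau _ _ _ _ _ _ n ψ hψ _ ?_, ?_⟩
      · rw [← Ideal.map_pow]
        exact Submodule.smul_mem_smul (Ideal.mem_map_of_mem σ hr) hg
      · rw [hψT, hsmul]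
    | add x _ y _ hx hy => rw [map_add]; exact add_mem hx hy

end FiniteData

end Transformation

section HeightOne

variable {R K : Type*} [CommRing R] [IsDomain R] [IsNoetherianRing R] [IsIntegrallyClosed R]
  [Field K] [Algebra R K] [IsFractionRing R K]

/-- A Noetherian integrally closed domain is the intersection of its localizations at the primes of
height one. -/
theorem mem_range_of_forall_height_one (f : K)
    (hf : ∀ 𝔭 : Ideal R, 𝔭.IsPrime → 𝔭.height = 1 →
      ∃ a s : R, s ∉ 𝔭 ∧ algebraMap R K s * f = algebraMap R K a) :
    f ∈ (algebraMap R K).range := by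
  have hinj := IsFractionRing.injective R K
  obtain ⟨a, b, hb, rfl⟩ := IsFractionRing.div_surjective (A := R) f
  have hb0 := nonZeroDivisors.ne_zero hb
  have hbK : algebraMap R K b ≠ 0 := by simpa using hb0
  by_contra hnot
  have ha : Ideal.Quotient.mk (Ideal.span {b}) a ≠ 0 := by
    rw [Ne, Ideal.Quotient.eq_zero_iff_mem, Ideal.mem_span_singleton]
    rintro ⟨c, rfl⟩
    exact hnot ⟨c, by rw [map_mul, mul_div_cancel_left₀ _ hbK]⟩
  obtain ⟨𝔭, h𝔭, hle⟩ := exists_le_isAssociatedPrime_of_isNoetherianRing R _ ha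
  obtain ⟨hprime, m, hm⟩ := (isAssociatedPrime_iff).1 h𝔭
  obtain ⟨d, rfl⟩ := Ideal.Quotient.mk_surjective m
  have hmem : ∀ r : R, r ∈ 𝔭 ↔ ∃ c, r * d = b * c := by
    intro r
    rw [hm, Submodule.mem_colon_singleton, Submodule.mem_bot, Algebra.smul_def,
      Ideal.Quotient.algebraMap_eq, ← map_mul, Ideal.Quotient.eq_zero_iff_mem,
      Ideal.mem_span_singleton]
    rfl
  have hmul : ∀ r ∈ 𝔭, ∃ c : R, algebraMap R K r * (algebraMap R K d / algebraMap R K b) =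
      algebraMap R K c := by
    intro r hr
    obtain ⟨c, hc⟩ := (hmem r).1 hr
    refine ⟨c, ?_⟩
    rw [← mul_div_assoc, ← map_mul, hc, map_mul, mul_div_cancel_left₀ _ hbK]
  have hbp : b ∈ 𝔭 := (hmem b).2 ⟨d, rfl⟩
  have hne : 𝔭 ≠ ⊥ := fun h0 => hb0 (by simpa [h0] using hbp)
  have hheight : 𝔭.height = 1 := by
    by_cases hcase : ∀ r ∈ 𝔭, ∃ c ∈ 𝔭, algebraMap R K r *
        (algebraMap R K d / algebraMap R K b) = algebraMap R K c
    · exfalso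
      have hintegral : IsIntegral R (algebraMap R K d / algebraMap R K b) := by
        refine isIntegral_of_smul_mem_submodule (A := K)
          (N := Submodule.map (Algebra.linearMap R K) 𝔭) ?_ ?_ _ ?_
        · exact (Submodule.ne_bot_iff _).2 ⟨algebraMap R K b, ⟨b, hbp, rfl⟩, hbK⟩
        · exact (IsNoetherian.noetherian 𝔭).map _
        · rintro _ ⟨r, hr, rfl⟩
          obtain ⟨c, hc, hrc⟩ := hcase r hr
          exact ⟨c, hc, by simpa [mul_comm] using hrc.symm⟩
      obtain ⟨c, hc⟩ := IsIntegrallyClosed.isIntegral_iff.1 hintegral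
      refine hprime.ne_top ((Ideal.eq_top_iff_one _).2 ((hmem 1).2 ⟨c, hinj ?_⟩))
      rw [one_mul, map_mul, hc, mul_div_cancel₀ _ hbK]
    · push Not at hcase
      obtain ⟨r, hr, hrc⟩ := hcase
      obtain ⟨u, hu⟩ := hmul r hr
      have hu𝔭 : u ∉ 𝔭 := fun h0 => hrc u h0 hu
      refine le_antisymm ?_ ?_
      · refine Ideal.height_le_one_of_isPrincipal_of_mem_minimalPrimes (Ideal.span {r}) 𝔭
          ⟨⟨hprime, by simpa [Ideal.span_le] using hr⟩, fun 𝔮 h𝔮 h𝔮𝔭 s hs => ?_⟩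
        obtain ⟨c, hc⟩ := hmul s hs
        have : u * s = c * r := hinj (by rw [map_mul, map_mul, ← hu, ← hc]; ring)
        have hmem : u * s ∈ 𝔮 :=
          this ▸ Ideal.mul_mem_left _ _ (h𝔮.2 (Ideal.mem_span_singleton_self r))
        exact (h𝔮.1.mem_or_mem hmem).resolve_left fun h0 => hu𝔭 (h𝔮𝔭 h0)
      · rw [Order.one_le_iff_ne_zero, Ne, Ideal.height_eq_zero_iff,
          IsDomain.minimalPrimes_eq_singleton_bot]
        exact hne
  obtain ⟨a', s, hs, hsa⟩ := hf 𝔭 hprime hheight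
  refine hs (hle ?_)
  rw [Submodule.mem_colon_singleton, Submodule.mem_bot, Algebra.smul_def,
      Ideal.Quotient.algebraMap_eq, ← map_mul, Ideal.Quotient.eq_zero_iff_mem,
      Ideal.mem_span_singleton]
  refine ⟨a', hinj ?_⟩
  rw [map_mul, map_mul, ← hsa]
  field_simp

/-- The orders of vanishing at the height one primes of a normal Noetherian domain. -/
theorem divisorialData_of_primes {α : Type*} {P : Set α} {v : K → α → ℤ} (𝔭 : α → Ideal R)
    (hv : IsOrder P v) (hprime : ∀ x ∈ P, (𝔭 x).IsPrime) (hheight : ∀ x ∈ P, (𝔭 x).height = 1)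
    (hinj : ∀ x ∈ P, ∀ y ∈ P, 𝔭 x = 𝔭 y → x = y)
    (hsurj : ∀ 𝔮 : Ideal R, 𝔮.IsPrime → 𝔮.height = 1 → ∃ x ∈ P, 𝔭 x = 𝔮)
    (hnonneg : ∀ x ∈ P, ∀ r : R, r ≠ 0 → 0 ≤ v (algebraMap R K r) x)
    (hpos : ∀ x ∈ P, ∀ r : R, r ≠ 0 → (0 < v (algebraMap R K r) x ↔ r ∈ 𝔭 x))
    (hfrac : ∀ x ∈ P, ∀ f : K, f ≠ 0 → 0 ≤ v f x →
      ∃ a s : R, s ∉ 𝔭 x ∧ algebraMap R K s * f = algebraMap R K a)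
    (hunif : ∀ x ∈ P, ∃ f : K, f ≠ 0 ∧ v f x = 1) : DivisorialData R P v := by
  have hmin : ∀ x ∈ P, ∀ y ∈ P, 𝔭 x ≤ 𝔭 y → x = y := by
    intro x hx y hy hle
    have := hprime x hx
    have := hprime y hy
    refine hinj x hx y hy ?_
    by_contra hne
    have hlt := lt_of_le_of_ne hle hne
    have h1 := Ideal.height_strict_mono_of_isPrime_of_isPrime hlt
    rw [hheight x hx, hheight y hy] at h1
    exact lt_irrefl _ h1
  have hfin : ∀ a : R, a ≠ 0 → {x ∈ P | a ∈ 𝔭 x}.Finite := by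
    intro a ha
    refine Set.Finite.of_finite_image (f := 𝔭)
      ((Ideal.finite_minimalPrimes_of_isNoetherianRing R (Ideal.span {a})).subset ?_)
      fun x hx y hy hxy => hinj x hx.1 y hy.1 hxy
    rintro _ ⟨x, ⟨hx, hax⟩, rfl⟩
    have := hprime x hx
    refine ⟨⟨hprime x hx, by simpa [Ideal.span_le] using hax⟩, fun 𝔮 h𝔮 hle => ?_⟩
    have := h𝔮.1
    by_contra hnot
    have hlt : 𝔮 < 𝔭 x := lt_of_le_not_ge hle hnot
    have hbot : 𝔮 ≠ ⊥ := fun h0 => ha (by simpa [h0] using h𝔮.2 (Ideal.mem_span_singleton_self a))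
    have h1 := Ideal.height_strict_mono_of_isPrime_of_isPrime hlt
    rw [hheight x hx, Order.lt_one_iff, Ideal.height_eq_zero_iff,
      IsDomain.minimalPrimes_eq_singleton_bot] at h1
    exact hbot h1
  refine { toIsOrder := hv, mem_range_iff := fun f => ⟨?_, fun hf => ?_⟩,
           finite_support := fun f hf => ?_, exists_uniformizer := hunif,
           exists_separating := fun x hx F hF hxF n => ?_ }
  · rintro ⟨r, rfl⟩ h0 x hx
    simpa using hnonneg x hx r (by rintro rfl; simp at h0)
  · by_cases hf0 : f = 0
    · exact ⟨0, by simp [hf0]⟩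
    refine mem_range_of_forall_height_one f fun 𝔮 h𝔮 hq1 => ?_
    obtain ⟨x, hx, rfl⟩ := hsurj 𝔮 h𝔮 hq1
    exact hfrac x hx f hf0 (by simpa using hf hf0 x hx)
  · obtain ⟨a, b, hb, rfl⟩ := IsFractionRing.div_surjective (A := R) f
    have hb0 := nonZeroDivisors.ne_zero hb
    have ha0 : a ≠ 0 := by rintro rfl; simp at hf
    refine ((hfin a ha0).union (hfin b hb0)).subset fun x hx => ?_
    by_contra hc
    simp only [Set.mem_union, Set.mem_ofPred_eq, hx.1, true_and, not_or] at hc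
    have h1 := hnonneg x hx.1 a ha0
    have h2 := hnonneg x hx.1 b hb0
    have h3 := mt (hpos x hx.1 a ha0).1 hc.1
    have h4 := mt (hpos x hx.1 b hb0).1 hc.2
    have haK : algebraMap R K a ≠ 0 := by simpa using ha0
    have hbK : algebraMap R K b ≠ 0 := by simpa using hb0
    refine hx.2 ?_
    rw [div_eq_mul_inv, hv.map_mul haK (inv_ne_zero hbK) x hx.1, hv.map_inv hbK hx.1]
    omega
  · have hex : ∀ y : α, ∃ s : R, y ∈ F → s ∈ 𝔭 y ∧ s ∉ 𝔭 x := by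
      intro y
      by_cases hy : y ∈ F
      · have : ¬ 𝔭 y ≤ 𝔭 x := fun hle => hxF (hmin y (hF hy) x hx hle ▸ hy)
        obtain ⟨s, hs, hs'⟩ := Set.not_subset.1 this
        exact ⟨s, fun _ => ⟨hs, hs'⟩⟩
      · exact ⟨0, fun h => absurd h hy⟩
    choose s hs using hex
    have := hprime x hx
    have hnot : ∏ y ∈ F, s y ^ n ∉ 𝔭 x := by
      intro hmem
      obtain ⟨y, hy, hy'⟩ := (Ideal.IsPrime.prod_mem_iff).1 hmem
      exact (hs y hy).2 (‹(𝔭 x).IsPrime›.mem_of_pow_mem _ hy')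
    have h0 : ∏ y ∈ F, s y ^ n ≠ 0 := fun h0 => hnot (h0 ▸ zero_mem _)
    refine ⟨∏ y ∈ F, s y ^ n,
      (map_ne_zero_iff _ (IsFractionRing.injective R K)).2 h0, ?_, fun y hy => ?_⟩
    · have h1 := hnonneg x hx _ h0
      have h2 := mt (hpos x hx _ h0).1 hnot
      omega
    · obtain ⟨c, hc⟩ := Finset.dvd_prod_of_mem (fun y => s y ^ n) hy
      rw [hc] at h0 ⊢
      have hc0 : c ≠ 0 := right_ne_zero_of_mul h0
      have hsn0 : s y ^ n ≠ 0 := left_ne_zero_of_mul h0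
      have hs0 : s y ≠ 0 := fun h1 => (hs y hy).2 (h1 ▸ zero_mem _)
      have hsK : algebraMap R K (s y) ≠ 0 := by simpa using hs0
      rw [map_mul, hv.map_mul (by simpa using hsn0) (by simpa using hc0) y (hF hy), map_pow,
        hv.map_pow hsK n (hF hy)]
      have h1 := hnonneg y (hF hy) c hc0
      have h2 := (hpos y (hF hy) _ hs0).2 (hs y hy).1
      have h3 : (n : ℤ) * 1 ≤ n * v (algebraMap R K (s y)) y := by gcongr; omega
      omega

end HeightOne

section Primes

variable {X : Scheme.{u}}

theorem isIntegrallyClosed_sections [AlgebraicGeometry.IsIntegral X]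
    (hX : IsNormalScheme X) {U : X.Opens}
    (hU : IsAffineOpen U) [Nonempty U] : IsIntegrallyClosed Γ(X, U) := by
  refine IsIntegrallyClosed.of_localization_maximal fun 𝔪 _ _ => ?_
  let y : PrimeSpectrum Γ(X, U) := ⟨𝔪, inferInstance⟩
  have hy : hU.fromSpec y ∈ U := by
    have := Set.mem_range_self (f := hU.fromSpec) y
    rwa [hU.range_fromSpec] at this
  have := (hX (hU.fromSpec y)).2
  let := TopCat.Presheaf.algebra_section_stalk X.presheaf (⟨hU.fromSpec y, hy⟩ : U)
  have : IsLocalization.AtPrime (X.presheaf.stalk (hU.fromSpec y)) 𝔪 :=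
    hU.isLocalization_stalk' y hy
  exact IsIntegrallyClosed.of_equiv (IsLocalization.algEquiv 𝔪.primeCompl
    (X.presheaf.stalk (hU.fromSpec y)) (Localization.AtPrime 𝔪)).toRingEquiv

theorem mem_primeIdealOf_iff {U : X.Opens} (hU : IsAffineOpen U) {x : X} (hx : x ∈ U)
    (r : Γ(X, U)) : r ∈ (hU.primeIdealOf ⟨x, hx⟩).asIdeal ↔
      ¬ IsUnit (X.presheaf.germ U x hx r) := by
  rw [hU.primeIdealOf_eq_map_closedPoint]
  exact IsLocalRing.mem_maximalIdeal _

theorem height_primeIdealOf {U : X.Opens} (hU : IsAffineOpen U) {x : X} (hx : x ∈ U) :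
    (hU.primeIdealOf ⟨x, hx⟩).asIdeal.height = coheight x := by
  have h := ringKrullDim_stalk_eq_coheight x
  let := TopCat.Presheaf.algebra_section_stalk X.presheaf (⟨x, hx⟩ : U)
  have : IsLocalization.AtPrime (X.presheaf.stalk x) (hU.primeIdealOf ⟨x, hx⟩).asIdeal :=
    hU.isLocalization_stalk ⟨x, hx⟩
  rw [IsLocalization.AtPrime.ringKrullDim_eq_height (hU.primeIdealOf ⟨x, hx⟩).asIdeal] at h
  exact WithBot.coe_injective h

theorem exists_primeIdealOf_eq {U : X.Opens} (hU : IsAffineOpen U) (𝔮 : PrimeSpectrum Γ(X, U)) :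
    ∃ x, ∃ hx : x ∈ U, hU.primeIdealOf ⟨x, hx⟩ = 𝔮 := by
  have hy : hU.fromSpec 𝔮 ∈ U := by
    have := Set.mem_range_self (f := hU.fromSpec) 𝔮
    rwa [hU.range_fromSpec] at this
  exact ⟨_, hy, hU.fromSpec.injective (hU.fromSpec_primeIdealOf ⟨_, hy⟩)⟩

theorem primeIdealOf_injective {U : X.Opens} (hU : IsAffineOpen U) {x y : X} (hx : x ∈ U)
    (hy : y ∈ U) (h : (hU.primeIdealOf ⟨x, hx⟩).asIdeal = (hU.primeIdealOf ⟨y, hy⟩).asIdeal) :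
    x = y := by
  have h1 := hU.fromSpec_primeIdealOf ⟨x, hx⟩
  rw [PrimeSpectrum.ext h, hU.fromSpec_primeIdealOf ⟨y, hy⟩] at h1
  exact h1.symm

/-- The prime divisors that meet `U`. -/
def primeDivisors (U : X.Opens) : Set X := {x | x ∈ U ∧ coheight x = 1}

end Primes

section Points

variable {X : Scheme.{u}} [AlgebraicGeometry.IsIntegral X] [AlgebraicGeometry.IsNoetherian X]

theorem isDiscreteValuationRing_stalk (hX : IsNormalScheme X) {x : X} (hx : coheight x = 1) :
    IsDiscreteValuationRing (X.presheaf.stalk x) := by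
  have := (hX x).2
  have hdim : ringKrullDim (X.presheaf.stalk x) = 1 := by
    rw [ringKrullDim_stalk_eq_coheight, hx]
    rfl
  have hfield : ¬ IsField (X.presheaf.stalk x) := fun h => by
    rw [ringKrullDim_eq_zero_of_isField h] at hdim
    exact zero_ne_one hdim
  have : Ring.KrullDimLE 1 (X.presheaf.stalk x) := krullDimLE_of_coheight_le hx.le
  have h := (IsDiscreteValuationRing.TFAE (X.presheaf.stalk x) hfield).out 0 3
  exact h.2 ⟨inferInstance, IsLocalRing.maximalIdeal _,
    ⟨mt IsLocalRing.isField_iff_maximalIdeal_eq.2 hfield, inferInstance⟩,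
    fun I hI => IsLocalRing.eq_maximalIdeal (hI.2.isMaximal_of_ne_bot hI.1)⟩

theorem ord_algebraMap_nonneg {x : X} (hx : coheight x = 1) {s : X.presheaf.stalk x} (hs : s ≠ 0) :
    0 ≤ Scheme.ord (algebraMap (X.presheaf.stalk x) X.functionField s) x := by
  have : Ring.KrullDimLE 1 (X.presheaf.stalk x) := krullDimLE_of_coheight_le hx.le
  rw [Scheme.le_ord_iff hx (by simpa using hs)]
  exact Ring.ordFrac_ge_one_of_ne_zero hs

theorem ord_algebraMap_eq_zero_iff (hX : IsNormalScheme X) {x : X} (hx : coheight x = 1)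
    {s : X.presheaf.stalk x} (hs : s ≠ 0) :
    Scheme.ord (algebraMap (X.presheaf.stalk x) X.functionField s) x = 0 ↔ IsUnit s := by
  have := isDiscreteValuationRing_stalk hX hx
  rw [Scheme.ord_eq_iff hx (by simpa using hs)]
  exact Ring.isUnit_iff_ordFrac_one_of_isDiscreteValuationRing.symm

theorem exists_algebraMap_eq_of_ord_nonneg (hX : IsNormalScheme X) {x : X} (hx : coheight x = 1)
    {f : X.functionField} (hf : f ≠ 0) (h : 0 ≤ Scheme.ord f x) :
    ∃ s : X.presheaf.stalk x, algebraMap (X.presheaf.stalk x) X.functionField s = f := by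
  have := isDiscreteValuationRing_stalk hX hx
  rw [Scheme.le_ord_iff hx hf] at h
  have h' : (1 : WithZero (Multiplicative ℤ)) ≤ Ring.ordFrac (X.presheaf.stalk x) f := h
  rw [Ring.ordFrac_eq_valuation_inv] at h'
  refine IsDiscreteValuationRing.exists_lift_of_le_one ?_
  simpa using inv_le_one_of_one_le₀ h'

theorem ord_algebraMap_irreducible (hX : IsNormalScheme X) {x : X} (hx : coheight x = 1)
    {s : X.presheaf.stalk x} (hs : Irreducible s) :
    Scheme.ord (algebraMap (X.presheaf.stalk x) X.functionField s) x = 1 := by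
  have := isDiscreteValuationRing_stalk hX hx
  rw [Scheme.ord_eq_iff hx (by simpa using hs.ne_zero)]
  exact Ring.ordFrac_irreducible hs

theorem isOrder_ord (hX : IsNormalScheme X) :
    IsOrder {x : X | coheight x = 1} (fun f : X.functionField => Scheme.ord f) where
  map_mul hf hg _ _ := Scheme.ord_mul hf hg
  map_add _ _ hfg x hx := by
    have := isDiscreteValuationRing_stalk hX hx
    exact Scheme.ord_add hfg

open scoped Classical in
theorem divisorialData_ord (hX : IsNormalScheme X) {U : X.Opens} (hU : IsAffineOpen U)
    [Nonempty U] :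
    DivisorialData Γ(X, U) (primeDivisors U) (fun f : X.functionField => Scheme.ord f) := by
  have := functionField_isFractionRing_of_isAffineOpen X U hU
  have : IsNoetherianRing Γ(X, U) := IsLocallyNoetherian.component_noetherian ⟨U, hU⟩
  have := isIntegrallyClosed_sections hX hU
  have hne : ∀ x (hx : x ∈ U) (r : Γ(X, U)), r ≠ 0 → X.presheaf.germ U x hx r ≠ 0 :=
    fun x hx r hr => (map_ne_zero_iff _ (germ_injective_of_isIntegral X x hx)).2 hr
  have halg : ∀ x (hx : x ∈ U) (r : Γ(X, U)), algebraMap Γ(X, U) X.functionField r =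
      algebraMap (X.presheaf.stalk x) X.functionField (X.presheaf.germ U x hx r) :=
    fun x hx r => (Scheme.algebraMap_germ_eq_germToFunctionField X hx r).symm
  refine divisorialData_of_primes
    (fun x => if hx : x ∈ U then (hU.primeIdealOf ⟨x, hx⟩).asIdeal else ⊥)
    ((isOrder_ord hX).mono fun x hx => hx.2) ?_ ?_ ?_ ?_ ?_ ?_ ?_ ?_
  · rintro x ⟨hx, -⟩
    rw [dif_pos hx]
    infer_instance
  · rintro x ⟨hx, hx1⟩
    rw [dif_pos hx, height_primeIdealOf hU hx, hx1]
  · rintro x ⟨hx, -⟩ y ⟨hy, -⟩ h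
    rw [dif_pos hx, dif_pos hy] at h
    exact primeIdealOf_injective hU hx hy h
  · intro 𝔮 h𝔮 h1
    obtain ⟨x, hx, h⟩ := exists_primeIdealOf_eq hU ⟨𝔮, h𝔮⟩
    have h' : (hU.primeIdealOf ⟨x, hx⟩).asIdeal = 𝔮 := by rw [h]
    exact ⟨x, ⟨hx, by rw [← height_primeIdealOf hU hx, h', h1]⟩, by rw [dif_pos hx, h']⟩
  · rintro x ⟨hx, hx1⟩ r hr
    rw [halg x hx]
    exact ord_algebraMap_nonneg hx1 (hne x hx r hr)
  · rintro x ⟨hx, hx1⟩ r hr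
    rw [halg x hx, dif_pos hx, mem_primeIdealOf_iff,
      ← ord_algebraMap_eq_zero_iff hX hx1 (hne x hx r hr)]
    have := ord_algebraMap_nonneg hx1 (hne x hx r hr)
    omega
  · rintro x ⟨hx, hx1⟩ f hf h0
    obtain ⟨s, rfl⟩ := exists_algebraMap_eq_of_ord_nonneg hX hx1 hf h0
    let := TopCat.Presheaf.algebra_section_stalk X.presheaf (⟨x, hx⟩ : U)
    have : IsLocalization.AtPrime (X.presheaf.stalk x) (hU.primeIdealOf ⟨x, hx⟩).asIdeal :=
      hU.isLocalization_stalk ⟨x, hx⟩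
    obtain ⟨⟨a, d⟩, had⟩ := IsLocalization.surj (hU.primeIdealOf ⟨x, hx⟩).asIdeal.primeCompl s
    refine ⟨a, d, by rw [dif_pos hx]; exact d.2, ?_⟩
    rw [halg x hx, halg x hx, ← map_mul, mul_comm]
    exact congrArg _ had
  · rintro x ⟨hx, hx1⟩
    have := isDiscreteValuationRing_stalk hX hx1
    obtain ⟨s, hs⟩ := IsDiscreteValuationRing.exists_irreducible (X.presheaf.stalk x)
    exact ⟨_, by simpa using hs.ne_zero, ord_algebraMap_irreducible hX hx1 hs⟩

end Points

section IntegralExtension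

variable {R S : Type*} [CommRing R] [CommRing S] [IsDomain R] [IsDomain S]
  [IsNoetherianRing R] [IsNoetherianRing S]

theorem height_eq_one_iff {𝔭 : Ideal R} [𝔭.IsPrime] :
    𝔭.height = 1 ↔ 𝔭 ≠ ⊥ ∧ ∀ 𝔮 : Ideal R, 𝔮.IsPrime → 𝔮 < 𝔭 → 𝔮 = ⊥ := by
  constructor
  · intro h
    refine ⟨?_, fun 𝔮 h𝔮 hlt => ?_⟩
    · rintro rfl
      simp at h
    · have h1 := Ideal.height_strict_mono_of_isPrime_of_isPrime hlt
      rw [h, Order.lt_one_iff, Ideal.height_eq_zero_iff,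
        IsDomain.minimalPrimes_eq_singleton_bot] at h1
      exact h1
  · rintro ⟨h0, h⟩
    refine le_antisymm ?_ ?_
    · obtain ⟨a, ha, ha0⟩ := Submodule.exists_mem_ne_zero_of_ne_bot h0
      refine Ideal.height_le_one_of_isPrincipal_of_mem_minimalPrimes (Ideal.span {a}) 𝔭
        ⟨⟨inferInstance, by simpa [Ideal.span_le] using ha⟩, fun 𝔮 h𝔮 hle => ?_⟩
      by_contra hnot
      have := h 𝔮 h𝔮.1 (lt_of_le_not_ge hle hnot)
      exact ha0 (by simpa [this] using h𝔮.2 (Ideal.mem_span_singleton_self a))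
    · rw [Order.one_le_iff_ne_zero, Ne, Ideal.height_eq_zero_iff,
        IsDomain.minimalPrimes_eq_singleton_bot]
      exact h0

variable {σ : R →+* S} (hσ : σ.Finite) (hinj : Function.Injective σ)
include hσ hinj

theorem height_comap_eq_one [IsIntegrallyClosed R] {𝔮 : Ideal S} [𝔮.IsPrime] (h : 𝔮.height = 1) :
    (𝔮.comap σ).height = 1 := by
  algebraize [σ]
  have : FaithfulSMul R S := (faithfulSMul_iff_algebraMap_injective R S).2 hinj
  rw [height_eq_one_iff] at h ⊢
  refine ⟨fun h0 => h.1 (Ideal.eq_bot_of_comap_eq_bot (R := R) h0), fun 𝔭 h𝔭 hlt => ?_⟩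
  have : 𝔮.LiesOver (𝔮.comap σ) := ⟨rfl⟩
  obtain ⟨𝔮', hlt', h𝔮', hover⟩ := Ideal.exists_ideal_lt_liesOver_of_lt 𝔮 hlt
  rw [h.2 𝔮' h𝔮' hlt'] at hover
  rw [hover.over]
  exact Ideal.comap_bot_of_injective σ hinj

theorem height_eq_one_of_comap {𝔮 : Ideal S} [𝔮.IsPrime] (h : (𝔮.comap σ).height = 1) :
    𝔮.height = 1 := by
  algebraize [σ]
  rw [height_eq_one_iff] at h ⊢
  refine ⟨?_, fun 𝔮' h𝔮' hlt => ?_⟩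
  · rintro rfl
    exact h.1 (Ideal.comap_bot_of_injective σ hinj)
  · exact Ideal.eq_bot_of_comap_eq_bot (R := R)
      (h.2 _ inferInstance (Ideal.IsIntegral.comap_lt_comap (R := R) hlt))

end IntegralExtension

section Morphism

variable {X Y : Scheme.{u}} [AlgebraicGeometry.IsIntegral X]

theorem app_injective (π : Y ⟶ X) [Surjective π] (U : X.Opens) :
    Function.Injective (π.app U).hom := by
  rw [injective_iff_map_eq_zero]
  intro a ha
  rw [← basicOpen_eq_bot_iff, eq_bot_iff]
  intro x hx
  obtain ⟨y, rfl⟩ := π.surjective x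
  have h : y ∈ π ⁻¹ᵁ X.basicOpen a := hx
  rw [Scheme.preimage_basicOpen] at h
  change y ∈ Y.basicOpen ((π.app U).hom a) at h
  rw [ha] at h
  simp at h

variable [AlgebraicGeometry.IsIntegral Y]

theorem stalkMap_ne_zero {π : Y ⟶ X} {τ : X.functionField →+* Y.functionField} {y : Y}
    (hτ : ∀ s : X.presheaf.stalk (π y), τ (algebraMap _ X.functionField s) =
      algebraMap (Y.presheaf.stalk y) Y.functionField (π.stalkMap y s))
    {s : X.presheaf.stalk (π y)} (hs : s ≠ 0) : π.stalkMap y s ≠ 0 := by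
  intro h
  have := hτ s
  rw [h, map_zero, map_eq_zero, map_eq_zero_iff _ (IsFractionRing.injective _ _)] at this
  exact hs this

variable [AlgebraicGeometry.IsNoetherian X] [AlgebraicGeometry.IsNoetherian Y]

theorem ord_algebraMap_eq_length {x : X} (hx : coheight x = 1) {s : X.presheaf.stalk x}
    (hs : s ≠ 0) : Scheme.ord (algebraMap (X.presheaf.stalk x) X.functionField s) x =
      (Module.length (X.presheaf.stalk x) (X.presheaf.stalk x ⧸ Ideal.span {s})).toNat := by
  have : Ring.KrullDimLE 1 (X.presheaf.stalk x) := krullDimLE_of_coheight_le hx.le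
  have hs' := mem_nonZeroDivisors_of_ne_zero hs
  rw [Scheme.ord_eq_iff hx (by simpa using hs)]
  refine (Ring.ordFrac_eq_ord _ hs).trans (Ring.ordMonoidWithZeroHom_eq_coe _ hs' ?_)
  exact (ENat.natCast_toNat (Ring.ord_ne_top hs')).symm

section

variable {π : Y ⟶ X} {τ : X.functionField →+* Y.functionField} {y : Y}
  (hτ : ∀ s : X.presheaf.stalk (π y), τ (algebraMap _ X.functionField s) =
    algebraMap (Y.presheaf.stalk y) Y.functionField (π.stalkMap y s))
include hτ

theorem ord_algebraMap_irreducible_eq_ramIndex (hX : IsNormalScheme X) (hy : coheight y = 1)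
    (hx : coheight (π y) = 1) {s : X.presheaf.stalk (π y)} (hs : Irreducible s) :
    Scheme.ord (algebraMap (Y.presheaf.stalk y) Y.functionField (π.stalkMap y s)) y =
      ramIndex π y := by
  have := isDiscreteValuationRing_stalk hX hx
  rw [ord_algebraMap_eq_length hy (stalkMap_ne_zero hτ hs.ne_zero), ramIndex,
    hs.maximalIdeal_eq, Ideal.map_span, Set.image_singleton]

theorem ramIndex_pos (hX : IsNormalScheme X) (hY : IsNormalScheme Y) (hy : coheight y = 1)
    (hx : coheight (π y) = 1) : 0 < ramIndex π y := by
  have := isDiscreteValuationRing_stalk hX hx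
  obtain ⟨s, hs⟩ := IsDiscreteValuationRing.exists_irreducible (X.presheaf.stalk (π y))
  have h0 := stalkMap_ne_zero hτ hs.ne_zero
  have h1 := ord_algebraMap_irreducible_eq_ramIndex hτ hX hy hx hs
  have h2 := (ord_algebraMap_eq_zero_iff hY hy h0).not.2 fun h =>
    hs.not_isUnit ((isUnit_map_iff (π.stalkMap y).hom s).1 h)
  omega

theorem ord_map_eq_ramIndex_mul (hX : IsNormalScheme X) (hY : IsNormalScheme Y)
    (hy : coheight y = 1) (hx : coheight (π y) = 1) {f : X.functionField} (hf : f ≠ 0) :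
    Scheme.ord (τ f) y = ramIndex π y * Scheme.ord f (π y) := by
  have := isDiscreteValuationRing_stalk hX hx
  have hX' := isOrder_ord hX
  have hY' := isOrder_ord hY
  obtain ⟨s, hs⟩ := IsDiscreteValuationRing.exists_irreducible (X.presheaf.stalk (π y))
  have key : ∀ a : X.presheaf.stalk (π y), a ≠ 0 →
      Scheme.ord (τ (algebraMap _ X.functionField a)) y =
        ramIndex π y * Scheme.ord (algebraMap _ X.functionField a) (π y) := by
    intro a ha
    obtain ⟨n, u, rfl⟩ := IsDiscreteValuationRing.eq_unit_mul_pow_irreducible ha hs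
    have hu0 : algebraMap _ X.functionField (u : X.presheaf.stalk (π y)) ≠ 0 := by simp
    have hs0 : algebraMap _ X.functionField s ≠ 0 := by simpa using hs.ne_zero
    have hus : Scheme.ord (algebraMap _ X.functionField (u : X.presheaf.stalk (π y))) (π y) = 0 :=
      (ord_algebraMap_eq_zero_iff hX hx u.ne_zero).2 u.isUnit
    have hut : Scheme.ord (τ (algebraMap _ X.functionField (u : X.presheaf.stalk (π y)))) y =
        0 := by
      rw [hτ]
      exact (ord_algebraMap_eq_zero_iff hY hy (stalkMap_ne_zero hτ u.ne_zero)).2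
        (u.isUnit.map (π.stalkMap y).hom)
    have h1 := hX'.map_pow hs0 n hx
    have h2 := hY'.map_pow ((map_ne_zero τ).2 hs0) n hy
    rw [map_mul, map_pow, Scheme.ord_mul hu0 (pow_ne_zero n hs0), map_mul, map_pow,
      Scheme.ord_mul ((map_ne_zero τ).2 hu0) (pow_ne_zero n ((map_ne_zero τ).2 hs0)), hus, hut,
      h1, h2, hτ, ord_algebraMap_irreducible_eq_ramIndex hτ hX hy hx hs,
      ord_algebraMap_irreducible hX hx hs]
    ring
  obtain ⟨a, b, hb, rfl⟩ := IsFractionRing.div_surjective (A := X.presheaf.stalk (π y)) f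
  have hb0 := nonZeroDivisors.ne_zero hb
  have ha0 : a ≠ 0 := by rintro rfl; simp at hf
  have ha0' : algebraMap _ X.functionField a ≠ 0 := by simpa using ha0
  have hb0' : algebraMap _ X.functionField b ≠ 0 := by simpa using hb0
  have h1 := hX'.map_inv hb0' hx
  have h2 := hY'.map_inv ((map_ne_zero τ).2 hb0') hy
  rw [div_eq_mul_inv, map_mul, map_inv₀, Scheme.ord_mul ha0' (inv_ne_zero hb0'),
    Scheme.ord_mul ((map_ne_zero τ).2 ha0') (inv_ne_zero ((map_ne_zero τ).2 hb0')), h1, h2,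
    key a ha0, key b hb0]
  ring

end

theorem exists_finiteData (hX : IsNormalScheme X) (hY : IsNormalScheme Y) (π : Y ⟶ X)
    [IsFinite π] [Surjective π] {U : X.Opens} (hU : IsAffineOpen U) [Nonempty U] :
    ∃ τ : X.functionField →+* Y.functionField, FiniteData (π.app U).hom τ
      (primeDivisors U) (fun f : X.functionField => Scheme.ord f)
      (primeDivisors (π ⁻¹ᵁ U)) (fun f : Y.functionField => Scheme.ord f) π (ramIndex π) := by
  have hV : IsAffineOpen (π ⁻¹ᵁ U) := hU.preimage π
  have := functionField_isFractionRing_of_isAffineOpen X U hU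
  have := functionField_isFractionRing_of_isAffineOpen Y (π ⁻¹ᵁ U) hV
  have := isIntegrallyClosed_sections hX hU
  have hinj := app_injective π U
  have : IsNoetherianRing Γ(X, U) := IsLocallyNoetherian.component_noetherian ⟨U, hU⟩
  have : IsNoetherianRing Γ(Y, π ⁻¹ᵁ U) := IsLocallyNoetherian.component_noetherian ⟨_, hV⟩
  have hfin : (π.app U).hom.Finite := π.finite_app U hU
  have hcomap : ∀ y (hy : y ∈ π ⁻¹ᵁ U),
      (hV.primeIdealOf ⟨y, hy⟩).asIdeal.comap (π.app U).hom =
        (hU.primeIdealOf ⟨π y, hy⟩).asIdeal := by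
    intro y hy
    have := IsAffineOpen.comap_primeIdealOf_appLE (f := π) (x := y) U hU (π ⁻¹ᵁ U) hV le_rfl hy
    rw [Scheme.Hom.app_eq_appLE, ← this]
    rfl
  let τ : X.functionField →+* Y.functionField := IsFractionRing.lift (A := Γ(X, U))
    (g := (algebraMap Γ(Y, π ⁻¹ᵁ U) Y.functionField).comp (π.app U).hom)
    ((IsFractionRing.injective _ _).comp hinj)
  have hτ : ∀ r, τ (algebraMap Γ(X, U) X.functionField r) =
      algebraMap Γ(Y, π ⁻¹ᵁ U) Y.functionField ((π.app U).hom r) := fun r =>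
    IsFractionRing.lift_algebraMap _ r
  have hstalk : ∀ y ∈ π ⁻¹ᵁ U, ∀ s : X.presheaf.stalk (π y),
      τ (algebraMap _ X.functionField s) =
        algebraMap (Y.presheaf.stalk y) Y.functionField (π.stalkMap y s) := by
    intro y hy s
    let := TopCat.Presheaf.algebra_section_stalk X.presheaf (⟨π y, hy⟩ : U)
    have : IsLocalization.AtPrime (X.presheaf.stalk (π y)) (hU.primeIdealOf ⟨π y, hy⟩).asIdeal :=
      hU.isLocalization_stalk ⟨π y, hy⟩
    have h : τ.comp (algebraMap (X.presheaf.stalk (π y)) X.functionField) =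
        (algebraMap (Y.presheaf.stalk y) Y.functionField).comp (π.stalkMap y).hom := by
      refine IsLocalization.ringHom_ext (hU.primeIdealOf ⟨π y, hy⟩).asIdeal.primeCompl ?_
      ext r
      have h1 : algebraMap (X.presheaf.stalk (π y)) X.functionField
          (X.presheaf.germ U (π y) hy r) = algebraMap Γ(X, U) X.functionField r :=
        Scheme.algebraMap_germ_eq_germToFunctionField X hy r
      have h2 : algebraMap (Y.presheaf.stalk y) Y.functionField
          (Y.presheaf.germ (π ⁻¹ᵁ U) y hy (π.app U r)) =
            algebraMap Γ(Y, π ⁻¹ᵁ U) Y.functionField (π.app U r) :=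
        Scheme.algebraMap_germ_eq_germToFunctionField Y hy _
      change τ (algebraMap (X.presheaf.stalk (π y)) X.functionField
        (X.presheaf.germ U (π y) hy r)) = algebraMap (Y.presheaf.stalk y) Y.functionField
          (π.stalkMap y (X.presheaf.germ U (π y) hy r))
      rw [h1, hτ r]
      exact h2.symm.trans (congrArg _ (π.germ_stalkMap_apply U y hy r).symm)
    exact congrArg (fun φ : X.presheaf.stalk (π y) →+* Y.functionField => φ s) h
  have hmaps : ∀ y ∈ primeDivisors (π ⁻¹ᵁ U), π y ∈ primeDivisors U := by
    rintro y ⟨hy, hy1⟩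
    refine ⟨hy, ?_⟩
    rw [← height_primeIdealOf hV hy] at hy1
    rw [← height_primeIdealOf hU hy, ← hcomap y hy]
    exact height_comap_eq_one hfin hinj hy1
  refine ⟨τ, { base := divisorialData_ord hX hU, top := divisorialData_ord hY hV, finite := hfin,
               comm := hτ, mapsTo := hmaps, exists_over := ?_, finite_fiber := ?_, ram_pos := ?_,
               order_map := ?_ }⟩
  · rintro x ⟨hx, hx1⟩
    obtain ⟨y, rfl⟩ := π.surjective x
    refine ⟨y, ⟨hx, ?_⟩, rfl⟩
    rw [← height_primeIdealOf hU hx, ← hcomap y hx] at hx1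
    rw [← height_primeIdealOf hV hx]
    exact height_eq_one_of_comap hfin hinj hx1
  · exact fun x _ => (π.finite_preimage_singleton x).subset Set.inter_subset_right
  · exact fun y hy => ramIndex_pos (hstalk y hy.1) hX hY hy.2 (hmaps y hy).2
  · exact fun y hy f hf => ord_map_eq_ramIndex_mul (hstalk y hy.1) hX hY hy.2 (hmaps y hy).2 hf

end Morphism

section Divisors

variable {X : Scheme.{u}}

theorem finite_support [AlgebraicGeometry.IsNoetherian X] {A : Type} [AddCommGroup A]
    (D : Divisor X A) : {x : X | D.1 x ≠ 0}.Finite := by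
  have h := (Function.locallyFinsupp.locallyFiniteSupport D.1).finite_inter_support_of_isCompact
    isCompact_univ
  exact h.subset fun x hx => ⟨trivial, hx⟩

theorem divisor_ext {A : Type} [AddCommGroup A] {D E : Divisor X A}
    (h : ∀ x : X, coheight x = 1 → D.1 x = E.1 x) : D = E := by
  refine Subtype.ext (DFunLike.ext _ _ fun x => ?_)
  by_cases hx : coheight x = 1
  · exact h x hx
  · rw [not_not.1 (mt (D.2 x) hx), not_not.1 (mt (E.2 x) hx)]

theorem ideal_ne_bot [AlgebraicGeometry.IsIntegral X] {𝔞 : X.IdealSheafData} (h𝔞 : 𝔞 ≠ ⊥)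
    (U : X.affineOpens) [Nonempty U.1] : 𝔞.ideal U ≠ ⊥ := by
  intro h
  refine h𝔞 (Scheme.IdealSheafData.ext (funext fun V => ?_))
  rw [Scheme.IdealSheafData.ideal_bot, Pi.bot_apply, eq_bot_iff]
  intro a ha
  rw [Ideal.mem_bot]
  by_cases hV : Nonempty V.1
  · have hη : ∀ W : X.Opens, Nonempty W → genericPoint X ∈ W := fun W hW =>
      ((genericPoint_spec X).mem_open_set_iff W.isOpen).mpr (by simpa using hW)
    obtain ⟨_, ⟨W, hW, rfl⟩, hηW, hWUV⟩ := X.isBasis_affineOpens.exists_subset_of_mem_open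
      (show genericPoint X ∈ ((U.1 ⊓ V.1 : X.Opens) : Set X) from
        ⟨hη U.1 inferInstance, hη V.1 hV⟩) (U.1 ⊓ V.1).isOpen
    have : Nonempty W := ⟨⟨_, hηW⟩⟩
    let W' : X.affineOpens := ⟨W, hW⟩
    have hU : W' ≤ U := fun x hx => (hWUV hx).1
    have hV : W' ≤ V := fun x hx => (hWUV hx).2
    have h1 := 𝔞.map_ideal hU
    rw [h, Ideal.map_bot] at h1
    have h2 := Ideal.mem_map_of_mem (X.presheaf.map (homOfLE hV).op).hom ha
    rw [𝔞.map_ideal hV, ← h1, Ideal.mem_bot] at h2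
    exact (map_eq_zero_iff _ (map_injective_of_isIntegral X (homOfLE hV))).1 h2
  · have : V.1 = ⊥ := by
      ext x
      simpa using fun hx => hV ⟨⟨x, hx⟩⟩
    have : Subsingleton Γ(X, V.1) := by
      rw [this]
      infer_instance
    exact Subsingleton.elim _ _

end Divisors

section TestIdeals

variable {X : Scheme.{u}} [AlgebraicGeometry.IsIntegral X] [AlgebraicGeometry.IsNoetherian X]

theorem divisorialSections_eq (D : X → ℤ) (U : X.Opens) :
    divisorialSections D U = secs (primeDivisors U) (fun f : X.functionField => Scheme.ord f) D :=
  Set.ext fun _ => ⟨fun h h0 x hx => h h0 x hx.1 hx.2, fun h h0 x hx hx1 => h h0 x ⟨hx, hx1⟩⟩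

theorem cartierMaps_eq (p : ℕ) (Δ : X → ℚ) (e : ℕ) (U : X.Opens) [Nonempty U] :
    cartierMaps p Δ e U = cartier Γ(X, U) (primeDivisors U)
      (fun f : X.functionField => Scheme.ord f) p Δ e := by
  simp only [cartierMaps, cartier, divisorialSections_eq]

theorem bigTestIdeal_eq_tau (hX : IsNormalScheme X) {p : ℕ} (hp : 0 < p) (Δ : Divisor X ℚ)
    {U : X.Opens} (hU : IsAffineOpen U) [Nonempty U] (I : Ideal Γ(X, U)) (t : ℝ) :
    bigTestIdeal p Δ U I t =
      tau (primeDivisors U) (fun f : X.functionField => Scheme.ord f) p Δ.1 I t := by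
  have := functionField_isFractionRing_of_isAffineOpen X U hU
  have hdata := divisorialData_ord hX hU
  have hex : ∃ f : Γ(X, U), f ≠ 0 ∧ ∀ x ∈ U, coheight x = 1 →
      0 ≤ Δ.1 x + (Scheme.ord (algebraMap Γ(X, U) X.functionField f) x : ℚ) := by
    obtain ⟨f, hf0, hf⟩ := hdata.exists_bound (fun x => ⌈-Δ.1 x⌉)
      ((finite_support Δ).subset fun x hx h0 => hx.2 (by simp [h0]))
    refine ⟨f, by rintro rfl; simp at hf0, fun x hx hx1 => ?_⟩
    have h1 : ((⌈-Δ.1 x⌉ : ℤ) : ℚ) ≤ _ := Int.cast_le.2 (hf x ⟨hx, hx1⟩)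
    have h2 := Int.le_ceil (-Δ.1 x)
    linarith
  rw [bigTestIdeal, dif_pos hex, testIdealEffective]
  simp only [cartierMaps_eq]
  exact hdata.comap_sInf_eq_tau hp _ hex.choose_spec.1 (fun _ _ => rfl)
    fun x hx => hex.choose_spec.2 x hx.1 hx.2

end TestIdeals

section MainResult

variable {X Y : Scheme.{u}} [AlgebraicGeometry.IsIntegral X] [AlgebraicGeometry.IsIntegral Y]
  {π : Y ⟶ X}

theorem IsStructureSheafLinear.map_mul [Surjective π] {T : Y.functionField →+ X.functionField}
    (hT : IsStructureSheafLinear π T) {U : X.Opens} (hU : IsAffineOpen U) [Nonempty U]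
    {τ : X.functionField →+* Y.functionField}
    (hτ : ∀ r, τ (algebraMap Γ(X, U) X.functionField r) =
      algebraMap Γ(Y, π ⁻¹ᵁ U) Y.functionField ((π.app U).hom r)) (a : X.functionField)
    (b : Y.functionField) : T (τ a * b) = a * T b := by
  have := functionField_isFractionRing_of_isAffineOpen X U hU
  obtain ⟨r, s, hs, rfl⟩ := IsFractionRing.div_surjective (A := Γ(X, U)) a
  have hs0 : algebraMap Γ(X, U) X.functionField s ≠ 0 := by
    simpa using nonZeroDivisors.ne_zero hs
  have h1 : ∀ (r : Γ(X, U)) b, T (τ (algebraMap Γ(X, U) X.functionField r) * b) =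
      algebraMap Γ(X, U) X.functionField r * T b := fun r b => by
    rw [hτ]
    exact hT U r b
  apply mul_left_cancel₀ hs0
  rw [← h1, ← mul_assoc, ← _root_.map_mul, mul_div_cancel₀ _ hs0, h1, ← mul_assoc,
    mul_div_cancel₀ _ hs0]

variable [AlgebraicGeometry.IsNoetherian X] [AlgebraicGeometry.IsNoetherian Y]

/-- The coefficient at `y` of the divisor of a functional `T`. -/
noncomputable def coeffOfMap (π : Y ⟶ X) (T : Y.functionField →+ X.functionField) (y : Y) : ℤ :=
  dualOrder ({z : Y | coheight z = 1} ∩ π ⁻¹' {π y}) (fun f : Y.functionField => Scheme.ord f) (π y)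
    (fun f : X.functionField => Scheme.ord f) T y

theorem coeffOfMap_eq (T : Y.functionField →+ X.functionField) {U : X.Opens} {y : Y}
    (hy : π y ∈ U) : coeffOfMap π T y =
      dualOrder (primeDivisors (π ⁻¹ᵁ U) ∩ π ⁻¹' {π y})
        (fun f : Y.functionField => Scheme.ord f) (π y)
        (fun f : X.functionField => Scheme.ord f) T y := by
  have : {z : Y | coheight z = 1} ∩ π ⁻¹' {π y} = primeDivisors (π ⁻¹ᵁ U) ∩ π ⁻¹' {π y} := by
    ext z
    constructor
    · rintro ⟨h1, h2⟩
      exact ⟨⟨show π z ∈ U from (show π z = π y from h2) ▸ hy, h1⟩, h2⟩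
    · rintro ⟨h1, h2⟩
      exact ⟨h1.2, h2⟩
  rw [coeffOfMap, this]

variable [IsFinite π] [Surjective π] (hX : IsNormalScheme X) (hY : IsNormalScheme Y)
  {T : Y.functionField →+ X.functionField} (hT : IsStructureSheafLinear π T) (hT0 : T ≠ 0)
include hX hY hT hT0

open scoped Classical in
theorem exists_divisor_coeffOfMap :
    ∃ R : Divisor Y ℤ, ∀ y : Y, coheight y = 1 → R.1 y = coeffOfMap π T y := by
  refine ⟨⟨{ toFun := fun y => if coheight y = 1 then coeffOfMap π T y else 0
             supportWithinDomain' := fun _ _ => trivial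
             supportLocallyFiniteWithinDomain' := ?_ }, fun y hy => ?_⟩, fun y hy => if_pos hy⟩
  · intro z _
    obtain ⟨_, ⟨U, hU, rfl⟩, hzU, -⟩ := X.isBasis_affineOpens.exists_subset_of_mem_open
      (Set.mem_univ (π z)) isOpen_univ
    have : Nonempty U := ⟨⟨_, hzU⟩⟩
    have hU : IsAffineOpen U := hU
    have := functionField_isFractionRing_of_isAffineOpen X U hU
    have := functionField_isFractionRing_of_isAffineOpen Y (π ⁻¹ᵁ U) (hU.preimage π)
    obtain ⟨τ, h⟩ := exists_finiteData hX hY π hU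
    refine ⟨π ⁻¹ᵁ U, (π ⁻¹ᵁ U).isOpen.mem_nhds hzU,
      (h.finite_dualOrder (hT.map_mul hU h.comm) hT0).subset ?_⟩
    rintro y ⟨hyU, hy⟩
    by_cases h1 : coheight y = 1
    · refine ⟨⟨hyU, h1⟩, ?_⟩
      rw [← coeffOfMap_eq T hyU]
      simpa [h1] using hy
    · simp [h1] at hy
  · by_contra h
    exact hy (if_neg h)

variable {R : Divisor Y ℤ} (hR : ∀ y : Y, coheight y = 1 → R.1 y = coeffOfMap π T y)
include hR

theorem forall_map_mem_divisorialSections_iff (E : Divisor X ℤ) (U : X.affineOpens) [Nonempty U.1]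
    (g : Y.functionField) :
    (∀ s : Γ(Y, π ⁻¹ᵁ U.1), T (algebraMap Γ(Y, π ⁻¹ᵁ U.1) Y.functionField s * g) ∈
      divisorialSections E.1 U.1) ↔ g ∈ secs (primeDivisors (π ⁻¹ᵁ U.1))
        (fun f : Y.functionField => Scheme.ord f)
        (fun y => R.1 y + ramIndex π y * E.1 (π y)) := by
  have := functionField_isFractionRing_of_isAffineOpen X U.1 U.2
  have := functionField_isFractionRing_of_isAffineOpen Y (π ⁻¹ᵁ U.1) (U.2.preimage π)
  obtain ⟨τ, h⟩ := exists_finiteData hX hY π U.2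
  simp only [divisorialSections_eq]
  exact h.mem_secs_iff (hT.map_mul U.2 h.comm) hT0
    (fun y hy => (hR y hy.2).trans (coeffOfMap_eq T hy.1)) E.1 g

theorem isDivisorOfMap_zero : IsDivisorOfMap π T 0 R := by
  intro U _ g
  rw [forall_map_mem_divisorialSections_iff hX hY hT hT0 hR 0 U g, divisorialSections_eq]
  have h0 : ∀ y, R.1 y + ramIndex π y * (0 : Divisor X ℤ).1 (π y) = R.1 y := fun y => by
    change R.1 y + ramIndex π y * 0 = R.1 y
    rw [mul_zero, add_zero]
  simp only [h0]

/-- The divisor of the functional `T (· * g)`. -/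
theorem coeff_eq_of_isDivisorOfMap {g : Y.functionField} (hg : g ≠ 0)
    {Θ : Y.functionField →+ X.functionField} (hΘ : ∀ b, Θ b = T (b * g)) {E : Divisor X ℤ}
    {D : Divisor Y ℤ} (hD : IsDivisorOfMap π Θ E D) {y : Y} (hy : coheight y = 1) :
    D.1 y = R.1 y + ramIndex π y * E.1 (π y) + Scheme.ord g y := by
  obtain ⟨_, ⟨U, hU, rfl⟩, hyU, -⟩ := X.isBasis_affineOpens.exists_subset_of_mem_open
    (Set.mem_univ (π y)) isOpen_univ
  have : Nonempty U := ⟨⟨_, hyU⟩⟩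
  have hU : IsAffineOpen U := hU
  obtain ⟨τ, h⟩ := exists_finiteData hX hY π hU
  have heq : secs (primeDivisors (π ⁻¹ᵁ U)) (fun f : Y.functionField => Scheme.ord f) D.1 =
      secs (primeDivisors (π ⁻¹ᵁ U)) (fun f : Y.functionField => Scheme.ord f)
        (fun y => R.1 y + ramIndex π y * E.1 (π y) + Scheme.ord g y) := by
    ext b
    rw [← h.top.toIsOrder.mul_mem_iff hg,
      ← forall_map_mem_divisorialSections_iff hX hY hT hT0 hR E ⟨U, hU⟩, ← divisorialSections_eq,
      hD ⟨U, hU⟩ b]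
    refine forall_congr' fun s => ?_
    rw [hΘ, mul_comm g b, mul_assoc]
  refine le_antisymm (h.top.le_of_secs_subset _ _ ?_ heq.subset y ⟨hyU, hy⟩)
    (h.top.le_of_secs_subset _ _ ?_ heq.superset y ⟨hyU, hy⟩)
  · exact (finite_support D).subset fun y hy => hy.2
  · refine (((finite_support R).union (h.finite_pullback
      ((finite_support E).subset fun x hx => hx.2))).union (h.top.finite_support g hg)).subset
        fun y hy => ?_
    by_contra hc
    simp only [Set.mem_union, Set.mem_ofPred_eq, hy.1, true_and, not_or, not_not] at hc
    exact hy.2 (by simp [hc.1.1, hc.1.2, hc.2])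

theorem eq_of_isDivisorOfMap_zero {D : Divisor Y ℤ} (hD : IsDivisorOfMap π T 0 D) : D = R := by
  refine divisor_ext fun y hy => ?_
  have h := coeff_eq_of_isDivisorOfMap hX hY hT hT0 hR one_ne_zero (fun b => by rw [mul_one]) hD hy
  have h1 : Scheme.ord (1 : Y.functionField) y = 0 := (isOrder_ord hY).map_one hy
  rw [h, h1]
  change R.1 y + ramIndex π y * 0 + 0 = R.1 y
  ring

theorem linEquiv_of_isUpperShriek {KX : Divisor X ℤ} {KY : Divisor Y ℤ}
    (h : IsUpperShriek π KX KY) : LinEquiv R (KY - Divisor.pullback π KX) := by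
  obtain ⟨Θ, hΘ0, hΘ, hdiv⟩ := h
  obtain ⟨_, ⟨U, hU, rfl⟩, hηU, -⟩ := X.isBasis_affineOpens.exists_subset_of_mem_open
    (Set.mem_univ (genericPoint X)) isOpen_univ
  have hU : IsAffineOpen U := hU
  have : Nonempty U := ⟨⟨_, hηU⟩⟩
  have := functionField_isFractionRing_of_isAffineOpen X U hU
  have := functionField_isFractionRing_of_isAffineOpen Y (π ⁻¹ᵁ U) (hU.preimage π)
  obtain ⟨τ, h⟩ := exists_finiteData hX hY π hU
  obtain ⟨g, hg⟩ := exists_eq_functional_mul τ (finite_fractionField _ τ h.comm h.finite) T Θ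
    (hT.map_mul hU h.comm) (hΘ.map_mul hU h.comm) hT0
  have hg0 : g ≠ 0 := by
    rintro rfl
    exact hΘ0 (AddMonoidHom.ext fun b => by simp [hg])
  refine ⟨g⁻¹, inv_ne_zero hg0, fun y hy => ?_⟩
  have h1 := coeff_eq_of_isDivisorOfMap hX hY hT hT0 hR hg0 hg hdiv hy
  have h2 : Scheme.ord g⁻¹ y = -Scheme.ord g y := (isOrder_ord hY).map_inv hg0 hy
  have h3 : (Divisor.pullback π KX).1 y = KX.1 (π y) * (ramIndex π y : ℤ) := if_pos hy
  have h4 : (KY - Divisor.pullback π KX).1 y = KY.1 y - (Divisor.pullback π KX).1 y := rfl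
  rw [h4, h3, h1, h2]
  ring

/-- The image under `T` of the test ideal of `π^* Δ - R` is the test ideal of `Δ`. -/
theorem image_bigTestIdeal {p : ℕ} [Fact p.Prime] (hXF : IsFFinite p X) (hYF : IsFFinite p Y)
    (Δ : Divisor X ℚ) {U : X.Opens} (hU : IsAffineOpen U) [Nonempty U] {I : Ideal Γ(X, U)}
    (hI : I ≠ ⊥) {t : ℝ} (ht : 0 ≤ t) :
    bigTestIdeal p Δ U I t ≠ ⊥ ∧
      T '' (bigTestIdeal p (Divisor.pullback π Δ - Divisor.toRat R) (π ⁻¹ᵁ U)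
        (I.map (π.app U).hom) t : Set Y.functionField) =
          (bigTestIdeal p Δ U I t : Set X.functionField) := by
  have hp : 0 < p := (Fact.out : p.Prime).pos
  have hV : IsAffineOpen (π ⁻¹ᵁ U) := hU.preimage π
  have := functionField_isFractionRing_of_isAffineOpen X U hU
  have := functionField_isFractionRing_of_isAffineOpen Y (π ⁻¹ᵁ U) hV
  have : IsNoetherianRing Γ(X, U) := IsLocallyNoetherian.component_noetherian ⟨U, hU⟩
  have : IsNoetherianRing Γ(Y, π ⁻¹ᵁ U) := IsLocallyNoetherian.component_noetherian ⟨_, hV⟩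
  obtain ⟨_, hFX⟩ := hXF ⟨U, hU⟩ inferInstance
  obtain ⟨_, hFY⟩ := hYF ⟨π ⁻¹ᵁ U, hV⟩ inferInstance
  have : CharP X.functionField p := charP_of_injective_algebraMap
    (IsFractionRing.injective Γ(X, U) X.functionField) p
  have : CharP Y.functionField p := charP_of_injective_algebraMap
    (IsFractionRing.injective Γ(Y, π ⁻¹ᵁ U) Y.functionField) p
  obtain ⟨τ, h⟩ := exists_finiteData hX hY π hU
  have hΔ : {x ∈ primeDivisors U | Δ.1 x ≠ 0}.Finite :=
    (finite_support Δ).subset fun x hx => hx.2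
  have hΔY : ∀ y ∈ primeDivisors (π ⁻¹ᵁ U),
      (Divisor.pullback π Δ - Divisor.toRat R).1 y = Δ.1 (π y) * ramIndex π y - R.1 y := by
    intro y hy
    have h3 : (Divisor.pullback π Δ).1 y = Δ.1 (π y) * (ramIndex π y : ℚ) := if_pos hy.2
    rw [← h3]
    rfl
  have hT' := hT.map_mul hU h.comm
  have hρ : ∀ y ∈ primeDivisors (π ⁻¹ᵁ U), R.1 y = _ :=
    fun y hy => (hR y hy.2).trans (coeffOfMap_eq T hy.1)
  have hIS : I.map (π.app U).hom ≠ ⊥ := fun h0 =>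
    hI ((Ideal.map_eq_bot_iff_of_injective (app_injective π U)).1 h0)
  rw [bigTestIdeal_eq_tau hX hp Δ hU, bigTestIdeal_eq_tau hY hp _ hV]
  refine ⟨h.base.tau_ne_bot hFX hΔ hI ht, Set.Subset.antisymm ?_ fun k hk => ?_⟩
  · rintro _ ⟨g, hg, rfl⟩
    exact h.map_tau_le hT' hT0 hρ hΔ hΔY (frobenius_fractionField_finite hFX)
      (frobenius_fractionField_finite hFY) hg
  · exact h.tau_le_map hT' hT0 hρ hΔ hΔY (h.top.tau_ne_bot hFY
      (h.finite_support_pullback_sub hT' hT0 hρ hΔ hΔY) hIS ht) hk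

end MainResult

end TestIdeal

theorem mainTheorem1 {p : ℕ} [Fact p.Prime] {X Y : Scheme.{u}}
    [AlgebraicGeometry.IsIntegral X] [AlgebraicGeometry.IsIntegral Y]
    [AlgebraicGeometry.IsNoetherian X] [AlgebraicGeometry.IsNoetherian Y]
    (hXn : TestIdeal.IsNormalScheme X) (hYn : TestIdeal.IsNormalScheme Y)
    (hXF : TestIdeal.IsFFinite p X) (hYF : TestIdeal.IsFFinite p Y)
    (π : Y ⟶ X) [IsFinite π] [Surjective π]
    (Δ : TestIdeal.Divisor X ℚ) (𝔞 : X.IdealSheafData) (h𝔞 : 𝔞 ≠ ⊥) (t : ℝ) (ht : 0 ≤ t)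
    (T : Y.functionField →+ X.functionField)
    (hT : TestIdeal.IsStructureSheafLinear π T) (hT0 : T ≠ 0) :
    -- the divisor `R` associated with `T` exists and is unique,
    ∃ R : TestIdeal.Divisor Y ℤ, TestIdeal.IsDivisorOfMap π T 0 R ∧
      (∀ R' : TestIdeal.Divisor Y ℤ, TestIdeal.IsDivisorOfMap π T 0 R' → R' = R) ∧
      -- it is linearly equivalent to `K_Y - π^* K_X`,
      (∀ (KX : TestIdeal.Divisor X ℤ) (KY : TestIdeal.Divisor Y ℤ),
        TestIdeal.IsUpperShriek π KX KY → TestIdeal.LinEquiv R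
          (KY - TestIdeal.Divisor.pullback π KX)) ∧
      -- and `T` maps the test ideal of `(Y, π^* Δ - R, (𝔞 𝒪_Y)^t)` onto the nonzero test ideal
      -- of `(X, Δ, 𝔞^t)`, over every affine open of `X`.
      ∀ (U : X.affineOpens) [Nonempty U.1],
        TestIdeal.bigTestIdeal p Δ U.1 (𝔞.ideal U) t ≠ ⊥ ∧
        T '' (TestIdeal.bigTestIdeal p
            (TestIdeal.Divisor.pullback π Δ - TestIdeal.Divisor.toRat R) (π ⁻¹ᵁ U.1)
            ((𝔞.ideal U).map (π.app U.1).hom) t : Set Y.functionField) =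
          (TestIdeal.bigTestIdeal p Δ U.1 (𝔞.ideal U) t : Set X.functionField) := by
  obtain ⟨R, hR⟩ := TestIdeal.exists_divisor_coeffOfMap hXn hYn hT hT0
  exact ⟨R, TestIdeal.isDivisorOfMap_zero hXn hYn hT hT0 hR,
    fun _ hR' => TestIdeal.eq_of_isDivisorOfMap_zero hXn hYn hT hT0 hR hR',
    fun _ _ hK => TestIdeal.linEquiv_of_isUpperShriek hXn hYn hT hT0 hR hK,
    fun U _ => TestIdeal.image_bigTestIdeal hXn hYn hT hT0 hR hXF hYF Δ U.2
      (TestIdeal.ideal_ne_bot h𝔞 U) ht⟩
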